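/- For a real number $y$ let $[y]$ denote the largest integer $\le y$, and let $\zeta$ be the Riemann zeta function. Let $r\ge2$ be an integer and let $1\le c_1\le\cdots\le c_r$ be real numbers. For real $x\ge1$ let $$S(x)=\#\bigl\{(m_1,\dots,m_r)\in\mathbb{Z}_{\ge1}^r : m_1,\dots,m_r\le x,\ \gcd([m_1^{c_1}],\dots,[m_r^{c_r}])=1\bigr\}.$$ (i) For every integer $k\ge2$ with $c_r<k$ and every real $x\ge1$, $$S(x)=\frac{1}{\zeta(r)}x^r+O\Bigl(x^{r-\frac{k-c_r}{2^k-1}}\Bigr),$$ where the implicit constant depends only on $r$, $c_1,\dots,c_r$ and $k$. (ii) Consequently, for every real $x\ge1$, $$S(x)=\frac{1}{\zeta(r)}x^r+O\Bigl(x^{r-2^{-(\lceil c_r\rceil+1)}}\Bigr),$$ where the implicit constant depends only on $r$ and $c_1,\dots,c_r$. -/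

import Mathlib

/-- The integer part `[m ^ c]` of a real power of a positive integer, for a real order `c`. -/
noncomputable def psTerm (c : ℝ) (m : ℕ) : ℕ := ⌊(m : ℝ) ^ c⌋₊

/-- The number of `r`-tuples of positive integers `m₁, …, m_r ≤ x` such that
`gcd ([m₁ ^ c₁], …, [m_r ^ c_r]) = 1`. -/
noncomputable def coprimeCount {r : ℕ} (c : Fin r → ℝ) (x : ℝ) : ℕ :=
  ((Fintype.piFinset fun _ : Fin r => Finset.Icc 1 ⌊x⌋₊).filter fun m =>
    (Finset.univ.gcd fun i => psTerm (c i) (m i)) = 1).card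

/-!
The number of coprime tuples is, by Möbius inversion, `∑ μ(d) ∏ᵢ Fᵢ(d)`, where `Fᵢ(d)` counts the
`m ≤ x` with `d ∣ [m ^ cᵢ]` (`coprimeCount_eq_sum_moebius`). If `Fᵢ(d)` is `x / d` up to an error
`E(d) = O(x ^ (1 - δ) * d ^ (-ε))`, with `δ = (k - c_r) / (2 ^ k - 1)` and some `ε > 0`, the formula
follows (`exists_norm_coprimeCount_natCast_sub_le`). For `d ≤ x ^ ρ`, with `ρ` slightly larger than
`δ`, replacing the product by `(x / d) ^ r` costs `O(E(d) * (x / d + E(d)) * x ^ (r - 2))`, which is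
summable to `O(x ^ (r - δ))`. For larger `d`, one factor `x / d + E(d)` is already smaller than
`x ^ (1 - δ)` by a power of `x`, and the sum over `d` of another factor is `O(x ^ (1 + η))` for every
`η > 0` by the divisor bound. The factor `d ^ (-ε)` is what makes both ranges converge.

The error estimate for one exponent `c` is `exists_abs_psCount_sub_le`. For integral `c` and
squarefree `d` the condition is `d ∣ m`, and the error is at most one. For other `c`, the condition
says that the fractional part of `m ^ c / d` is below `1 / d`. It is counted on dyadic blocks. The
indicator function is a difference of sawtooth functions, and the sawtooth lies between difference
quotients of the second periodic Bernoulli function, whose Fourier series converges absolutely. This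
gives an Erdős–Turán type inequality (`abs_card_fract_lt_sub_le`) which leaves the exponential sums
`∑ e(h * m ^ c / d)`.

These sums are estimated by van der Corput's derivative test of order `k`, here in a discrete form
about sequences with monotone `k`-th differences of exact order `lam` (`exists_norm_sum_expo_le`). It
is proved by induction on `k`, from the Kusmin–Landau inequality by Weyl differencing. Differences
of sequences obey the hypothesis again, so calculus enters only in the mean value theorem that
verifies it for powers. The main term of the test gives the saving `δ`. Its secondary terms are
negligible for `d ≤ M ^ (c - 1)` if `k - c < 2 - 2 / 2 ^ k`, while for larger `k` the test of order
`k - 1` saves more. For `d` above `M ^ (c - 1)` the test of order two, or the trivial bound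
`M ^ c / d`, gives the exponent `2/3`, which suffices because `δ < 1/3`.
-/

open Finset

/-! ### Exponential sums: the Kusmin–Landau and van der Corput inequalities -/

/-- The additive character `e(t) = exp (2πit)` of the real line. -/
noncomputable def expo (t : ℝ) : ℂ := Complex.exp (Complex.I * ((2 * Real.pi * t : ℝ) : ℂ))

lemma expo_add (s t : ℝ) : expo (s + t) = expo s * expo t := by
  unfold expo; rw [← Complex.exp_add]; push_cast; ring_nf

lemma norm_expo (t : ℝ) : ‖expo t‖ = 1 := by
  unfold expo; rw [mul_comm]; exact Complex.norm_exp_ofReal_mul_I _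

lemma conj_expo (t : ℝ) : (starRingEnd ℂ) (expo t) = expo (-t) := by
  unfold expo
  rw [← Complex.exp_conj, map_mul, Complex.conj_I, Complex.conj_ofReal]
  push_cast; ring_nf

lemma norm_expo_sub_one (t : ℝ) : ‖expo t - 1‖ = 2 * |Real.sin (Real.pi * t)| := by
  unfold expo
  rw [Complex.norm_exp_I_mul_ofReal_sub_one, norm_mul, Real.norm_eq_abs, Real.norm_eq_abs,
    abs_two]
  ring_nf

lemma norm_sum_expo_le (u : ℕ → ℝ) (s : Finset ℕ) : ‖∑ n ∈ s, expo (u n)‖ ≤ s.card := by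
  refine (norm_sum_le _ _).trans ?_
  simp [norm_expo]

lemma norm_sum_expo_neg (u : ℕ → ℝ) (s : Finset ℕ) :
    ‖∑ n ∈ s, expo (-u n)‖ = ‖∑ n ∈ s, expo (u n)‖ := by
  rw [← RCLike.norm_conj (∑ n ∈ s, expo (u n)), map_sum]
  simp [conj_expo]

/-- The weight used for Abel summation has constant real part, and its imaginary part is a
cotangent; its variation is therefore governed by monotonicity. -/
lemma inv_expo_sub_one {t : ℝ} (h0 : 0 < t) (h1 : t < 1) :
    1 / (expo t - 1) =
      -(1 / 2) - ((Real.cos (Real.pi * t) / Real.sin (Real.pi * t) / 2 : ℝ) : ℂ) * Complex.I := by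
  have hs : 0 < Real.sin (Real.pi * t) := Real.sin_pos_of_pos_of_lt_pi (by positivity)
    (by nlinarith [Real.pi_pos])
  have hne : expo t - 1 ≠ 0 := by
    rw [← norm_pos_iff, norm_expo_sub_one, abs_of_pos hs]; positivity
  have he : expo t = ((2 * Real.cos (Real.pi * t) ^ 2 - 1 : ℝ) : ℂ) +
      ((2 * Real.sin (Real.pi * t) * Real.cos (Real.pi * t) : ℝ) : ℂ) * Complex.I := by
    unfold expo
    rw [show Complex.I * ((2 * Real.pi * t : ℝ) : ℂ) = ((2 * (Real.pi * t) : ℝ) : ℂ) * Complex.I by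
      push_cast; ring, Complex.exp_mul_I, ← Complex.ofReal_cos, ← Complex.ofReal_sin,
      Real.cos_two_mul, Real.sin_two_mul]
  have h := Real.sin_sq_add_cos_sq (Real.pi * t)
  rw [div_eq_iff hne, he]
  generalize Real.sin (Real.pi * t) = s at *
  generalize Real.cos (Real.pi * t) = c at *
  have hs' : (s : ℂ) ≠ 0 := by exact_mod_cast hs.ne'
  have h' : (s : ℂ) ^ 2 + (c : ℂ) ^ 2 = 1 := by exact_mod_cast h
  push_cast
  field_simp
  linear_combination 2 * (s : ℂ) * c ^ 2 * Complex.I_sq + 2 * Complex.I * c * h'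

lemma cot_antitone {s t : ℝ} (h0 : 0 < s) (hst : s ≤ t) (h1 : t < 1) :
    Real.cos (Real.pi * t) / Real.sin (Real.pi * t)
      ≤ Real.cos (Real.pi * s) / Real.sin (Real.pi * s) := by
  have hp := Real.pi_pos
  have hs : 0 < Real.sin (Real.pi * s) := Real.sin_pos_of_pos_of_lt_pi (by positivity) (by nlinarith)
  have ht : 0 < Real.sin (Real.pi * t) :=
    Real.sin_pos_of_pos_of_lt_pi (by nlinarith) (by nlinarith)
  rw [div_le_div_iff₀ ht hs]
  have : 0 ≤ Real.sin (Real.pi * t - Real.pi * s) :=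
    Real.sin_nonneg_of_nonneg_of_le_pi (by nlinarith) (by nlinarith)
  rw [Real.sin_sub] at this
  linarith

/-- Abel summation, for a weight `w` that turns the terms `z n` into differences. -/
lemma sum_eq_of_mul_sub_eq (w z : ℕ → ℂ) (N : ℕ) (h : ∀ n ≤ N, w n * (z (n + 1) - z n) = z n) :
    ∑ n ∈ range (N + 1), z n =
      w N * z (N + 1) - w 0 * z 0 - ∑ n ∈ range N, (w (n + 1) - w n) * z (n + 1) := by
  induction N with
  | zero => simp only [zero_add, sum_range_one, range_zero, sum_empty]; linear_combination -h 0 le_rfl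
  | succ N ih =>
    rw [sum_range_succ, ih fun n hn => h n (by omega), sum_range_succ _ N]
    linear_combination -h (N + 1) le_rfl

lemma sum_abs_sub_of_monotone {c : ℕ → ℝ} {N : ℕ}
    (h : (∀ n < N, c n ≤ c (n + 1)) ∨ (∀ n < N, c (n + 1) ≤ c n)) :
    ∑ n ∈ range N, |c (n + 1) - c n| = |c N - c 0| := by
  rcases h with h | h
  · rw [sum_congr rfl fun n hn => abs_of_nonneg (sub_nonneg.2 (h n (mem_range.1 hn))),
      sum_range_sub, abs_of_nonneg]
    rw [← sum_range_sub]
    exact sum_nonneg fun n hn => sub_nonneg.2 (h n (mem_range.1 hn))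
  · rw [sum_congr rfl fun n hn => abs_of_nonpos (sub_nonpos.2 (h n (mem_range.1 hn))),
      sum_neg_distrib, sum_range_sub, abs_of_nonpos]
    rw [← sum_range_sub]
    exact sum_nonpos fun n hn => sub_nonpos.2 (h n (mem_range.1 hn))

/-- The Kusmin–Landau inequality: if the consecutive differences are monotone and lie in
`[θ, 1/2]`, the exponential sum is at most `1/θ`. -/
theorem kusmin_landau {u : ℕ → ℝ} {N : ℕ} {θ : ℝ} (hθ : 0 < θ)
    (hlo : ∀ n < N, θ ≤ u (n + 1) - u n) (hhi : ∀ n < N, u (n + 1) - u n ≤ 1 / 2)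
    (hmono : (∀ n, n + 1 < N → u (n + 1) - u n ≤ u (n + 2) - u (n + 1)) ∨
      (∀ n, n + 1 < N → u (n + 2) - u (n + 1) ≤ u (n + 1) - u n)) :
    ‖∑ n ∈ range N, expo (u n)‖ ≤ 1 / θ := by
  rcases N with _ | N
  · simp; positivity
  set δ : ℕ → ℝ := fun n => u (n + 1) - u n with hδ
  set w : ℕ → ℂ := fun n => 1 / (expo (δ n) - 1) with hw
  have hpos : ∀ n ≤ N, 0 < δ n := fun n hn => hθ.trans_le (hlo n (by omega))
  have hlt : ∀ n ≤ N, δ n < 1 := fun n hn => (hhi n (by omega)).trans_lt (by norm_num)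
  have hnorm : ∀ n ≤ N, 4 * θ ≤ ‖expo (δ n) - 1‖ := by
    intro n hn
    rw [norm_expo_sub_one]
    have h1 := Real.mul_le_sin (x := Real.pi * δ n) (by have := hpos n hn; positivity)
      (by have := hhi n (by omega); nlinarith [Real.pi_pos])
    have h2 : 2 / Real.pi * (Real.pi * δ n) = 2 * δ n := by field_simp
    have h3 := hlo n (by omega)
    have h4 := le_abs_self (Real.sin (Real.pi * δ n))
    change θ ≤ δ n at h3
    linarith
  have hwn : ∀ n ≤ N, ‖w n‖ ≤ 1 / (4 * θ) := by
    intro n hn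
    rw [hw]; simp only [norm_div, norm_one]
    exact one_div_le_one_div_of_le (by positivity) (hnorm n hn)
  have hsum := sum_eq_of_mul_sub_eq w (fun n => expo (u n)) N (by
    intro n hn
    have : expo (u (n + 1)) = expo (u n) * expo (δ n) := by rw [← expo_add]; simp [hδ]
    have hne : expo (δ n) - 1 ≠ 0 := by
      rw [← norm_pos_iff]; exact lt_of_lt_of_le (by positivity) (hnorm n hn)
    simp only [hw, this]
    field_simp)
  set c : ℕ → ℝ := fun n => Real.cos (Real.pi * δ n) / Real.sin (Real.pi * δ n) / 2 with hc
  have hwc : ∀ n ≤ N, w n = -(1 / 2) - (c n : ℂ) * Complex.I := fun n hn =>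
    inv_expo_sub_one (hpos n hn) (hlt n hn)
  have hcb : ∀ n ≤ N, |c n| ≤ 1 / (4 * θ) := by
    intro n hn
    have := (Complex.abs_im_le_norm (w n)).trans (hwn n hn)
    rw [hwc n hn] at this
    simpa using this
  have hdiff : ∀ n < N, ‖(w (n + 1) - w n) * expo (u (n + 1))‖ = |c (n + 1) - c n| := by
    intro n hn
    rw [norm_mul, norm_expo, mul_one, hwc n hn.le, hwc (n + 1) hn,
      show (-(1 / 2) - (c (n + 1) : ℂ) * Complex.I - (-(1 / 2) - (c n : ℂ) * Complex.I)) =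
        ((-(c (n + 1) - c n) : ℝ) : ℂ) * Complex.I by push_cast; ring]
    rw [norm_mul, Complex.norm_I, mul_one, Complex.norm_real, Real.norm_eq_abs, abs_neg]
  have hcm : (∀ n < N, c n ≤ c (n + 1)) ∨ (∀ n < N, c (n + 1) ≤ c n) := by
    rcases hmono with h | h
    · right
      intro n hn
      have := cot_antitone (hpos n hn.le) (h n (by omega)) (hlt (n + 1) hn)
      simp only [hc]; linarith
    · left
      intro n hn
      have := cot_antitone (hpos (n + 1) hn) (h n (by omega)) (hlt n hn.le)
      simp only [hc]; linarith
  rw [hsum]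
  have h1 : ‖w N * expo (u (N + 1))‖ ≤ 1 / (4 * θ) := by
    rw [norm_mul, norm_expo, mul_one]; exact hwn N le_rfl
  have h2 : ‖w 0 * expo (u 0)‖ ≤ 1 / (4 * θ) := by
    rw [norm_mul, norm_expo, mul_one]; exact hwn 0 (by omega)
  have h3 : ‖∑ n ∈ range N, (w (n + 1) - w n) * expo (u (n + 1))‖ ≤ 2 * (1 / (4 * θ)) := by
    refine (norm_sum_le _ _).trans ?_
    rw [sum_congr rfl fun n hn => hdiff n (mem_range.1 hn), sum_abs_sub_of_monotone hcm]
    have := hcb N le_rfl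
    have := hcb 0 (by omega)
    have := abs_sub (c N) (c 0)
    linarith
  have h4 := norm_sub_le (w N * expo (u (N + 1)) - w 0 * expo (u 0))
    (∑ n ∈ range N, (w (n + 1) - w n) * expo (u (n + 1)))
  have h5 := norm_sub_le (w N * expo (u (N + 1))) (w 0 * expo (u 0))
  have h6 : 1 / θ = 4 * (1 / (4 * θ)) := by field_simp
  rw [h6]
  linarith

/-- Summing a function of the distance `|i - l|` over `l < q`. -/
lemma sum_dist_le (g : ℕ → ℝ) (hg : ∀ j, 0 ≤ g j) (q i : ℕ) (hi : i < q) :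
    ∑ l ∈ range q, g (max i l - min i l) ≤ 2 * ∑ j ∈ range q, g j := by
  rw [← sum_filter_add_sum_filter_not (range q) (fun l => l ≤ i), two_mul]
  apply add_le_add
  · have hinj : Set.InjOn (fun l => i - l) ((range q).filter (fun l => l ≤ i)) := by
      intro a ha b hb hab
      simp only [coe_filter, Set.mem_ofPred_eq] at ha hb hab; omega
    rw [sum_congr rfl (g := fun l => g (i - l)) (by
      intro l hl; simp only [mem_filter] at hl; rw [max_eq_left hl.2, min_eq_right hl.2]),
      ← sum_image (f := g) hinj]
    apply sum_le_sum_of_subset_of_nonneg _ fun _ _ _ => hg _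
    intro a ha; simp only [mem_image, mem_filter, mem_range] at ha ⊢; omega
  · have hinj : Set.InjOn (fun l => l - i) ((range q).filter (fun l => ¬ l ≤ i)) := by
      intro a ha b hb hab
      simp only [coe_filter, Set.mem_ofPred_eq] at ha hb hab; omega
    rw [sum_congr rfl (g := fun l => g (l - i)) (by
      intro l hl; simp only [mem_filter, not_le] at hl
      rw [max_eq_right hl.2.le, min_eq_left hl.2.le]),
      ← sum_image (f := g) hinj]
    apply sum_le_sum_of_subset_of_nonneg _ fun _ _ _ => hg _
    intro a ha; simp only [mem_image, mem_filter, mem_range] at ha ⊢; omega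

lemma sum_Ico_shift_eq {a : ℤ → ℂ} {N : ℕ} (ha : ∀ n, a n ≠ 0 → 0 ≤ n ∧ n < N) {q : ℕ}
    {i : ℕ} (hi : i < q) :
    ∑ m ∈ Ico (0 : ℤ) (N + q), a (m - i) = ∑ n ∈ range N, a n := by
  symm
  have hsub : (range N).image (fun n : ℕ => (n : ℤ) + i) ⊆ Ico (0 : ℤ) (N + q) := by
    intro m hm
    simp only [mem_image, mem_range, mem_Ico] at hm ⊢
    obtain ⟨n, hn, rfl⟩ := hm
    omega
  rw [← sum_subset hsub, sum_image]
  · simp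
  · intro x _ y _ hxy; simpa using hxy
  · intro m hm hm'
    by_contra h
    obtain ⟨h0, h1⟩ := ha _ h
    apply hm'
    simp only [mem_image, mem_range]
    exact ⟨(m - i).toNat, by omega, by omega⟩

/-- The van der Corput (Weyl differencing) inequality. -/
theorem vanDerCorput_inequality (z : ℕ → ℂ) (N q : ℕ) (hq : 0 < q) (hqN : q ≤ N) :
    ‖∑ n ∈ range N, z n‖ ^ 2 ≤
      4 * N / q * ∑ j ∈ range q, ‖∑ n ∈ range (N - j), z (n + j) * (starRingEnd ℂ) (z n)‖ := by
  -- Extend `z` by zero to `ℤ`, so that shifted sums keep their value.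
  set a : ℤ → ℂ := fun m => if 0 ≤ m ∧ m < N then z m.toNat else 0 with ha
  have hsupp : ∀ n, a n ≠ 0 → 0 ≤ n ∧ n < N := by
    intro n h; by_contra h'; exact h (by simp only [ha, if_neg h'])
  have han : ∀ n : ℕ, n < N → a n = z n := by
    intro n hn; simp only [ha]; rw [if_pos (by omega)]; simp
  have hS : ∑ n ∈ range N, z n = ∑ n ∈ range N, a n :=
    sum_congr rfl fun n hn => (han n (mem_range.1 hn)).symm
  set S := ∑ n ∈ range N, z n
  set I := Ico (0 : ℤ) (N + q) with hI
  set g : ℕ → ℝ := fun j => ‖∑ n ∈ range (N - j), z (n + j) * (starRingEnd ℂ) (z n)‖ with hg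
  have h1 : (q : ℂ) * S = ∑ m ∈ I, ∑ i ∈ range q, a (m - i) := by
    rw [sum_comm, sum_congr rfl fun i hi => sum_Ico_shift_eq hsupp (mem_range.1 hi), ← hS]
    simp
  have h2 : (q : ℝ) ^ 2 * ‖S‖ ^ 2 ≤ (N + q) * ∑ m ∈ I, ‖∑ i ∈ range q, a (m - i)‖ ^ 2 := by
    have : (q : ℝ) * ‖S‖ ≤ ∑ m ∈ I, ‖∑ i ∈ range q, a (m - i)‖ := by
      rw [← Complex.norm_natCast, ← norm_mul, h1]; exact norm_sum_le _ _
    rw [← mul_pow]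
    refine (pow_le_pow_left₀ (by positivity) this 2).trans ?_
    refine (sq_sum_le_card_mul_sum_sq (s := I)).trans ?_
    rw [hI, Int.card_Ico, show ((N : ℤ) + q - 0).toNat = N + q by omega]
    push_cast; exact le_rfl
  have hcorr : ∀ i < q, ∀ l < q, i ≤ l →
      ‖∑ m ∈ I, a (m - i) * (starRingEnd ℂ) (a (m - l))‖ = g (l - i) := by
    intro i hi l hl hil
    have := sum_Ico_shift_eq (a := fun m => a (m + (l - i : ℕ)) * (starRingEnd ℂ) (a m))
      (N := N) (by
        intro n hn; apply hsupp; intro h0; apply hn; simp [h0]) hl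
    have h' : ∑ m ∈ I, a (m - i) * (starRingEnd ℂ) (a (m - l)) =
        ∑ n ∈ range N, a (n + (l - i : ℕ)) * (starRingEnd ℂ) (a n) := by
      rw [← this]
      apply sum_congr rfl
      intro m _
      rw [show m - (l : ℤ) + ((l - i : ℕ) : ℤ) = m - i by omega]
    rw [h', hg]
    congr 1
    rw [← sum_subset (range_subset_range.2 (Nat.sub_le N (l - i)))]
    · apply sum_congr rfl
      intro n hn
      rw [mem_range] at hn
      rw [han n (by omega), ← han (n + (l - i)) (by omega)]; push_cast; rfl
    · intro n hn hn'
      rw [mem_range] at hn hn'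
      have : a (n + (l - i : ℕ)) = 0 := by
        by_contra h; have := hsupp _ h; omega
      rw [this, zero_mul]
  have hcorr' : ∀ i < q, ∀ l < q,
      ‖∑ m ∈ I, a (m - i) * (starRingEnd ℂ) (a (m - l))‖ = g (max i l - min i l) := by
    intro i hi l hl
    rcases le_total i l with h | h
    · rw [hcorr i hi l hl h, max_eq_right h, min_eq_left h]
    · rw [max_eq_left h, min_eq_right h, ← hcorr l hl i hi h, ← RCLike.norm_conj, map_sum]
      congr 1; apply sum_congr rfl; intro m _; simp [mul_comm]
  have h3 : ∑ m ∈ I, ‖∑ i ∈ range q, a (m - i)‖ ^ 2 ≤ q * (2 * ∑ j ∈ range q, g j) := by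
    have e : ((∑ m ∈ I, ‖∑ i ∈ range q, a (m - i)‖ ^ 2 : ℝ) : ℂ) =
        ∑ i ∈ range q, ∑ l ∈ range q, ∑ m ∈ I, a (m - i) * (starRingEnd ℂ) (a (m - l)) := by
      push_cast
      have : ∀ m : ℤ, ((‖∑ i ∈ range q, a (m - i)‖ : ℂ)) ^ 2 =
          ∑ i ∈ range q, ∑ l ∈ range q, a (m - i) * (starRingEnd ℂ) (a (m - l)) := by
        intro m
        rw [← Complex.mul_conj', map_sum, sum_mul_sum]
      rw [sum_congr rfl fun m _ => this m, sum_comm]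
      apply sum_congr rfl; intro i _
      rw [sum_comm]
    calc ∑ m ∈ I, ‖∑ i ∈ range q, a (m - i)‖ ^ 2
        = ‖((∑ m ∈ I, ‖∑ i ∈ range q, a (m - i)‖ ^ 2 : ℝ) : ℂ)‖ := by
          rw [Complex.norm_real, Real.norm_of_nonneg (sum_nonneg fun _ _ => by positivity)]
      _ ≤ ∑ i ∈ range q, ∑ l ∈ range q, g (max i l - min i l) := by
          rw [e]
          refine (norm_sum_le _ _).trans (sum_le_sum fun i hi => ?_)
          refine (norm_sum_le _ _).trans (sum_le_sum fun l hl => ?_)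
          rw [hcorr' i (mem_range.1 hi) l (mem_range.1 hl)]
      _ ≤ ∑ i ∈ range q, 2 * ∑ j ∈ range q, g j :=
          sum_le_sum fun i hi => sum_dist_le g (fun j => norm_nonneg _) q i (mem_range.1 hi)
      _ = q * (2 * ∑ j ∈ range q, g j) := by simp
  have hq' : (0 : ℝ) < q := by exact_mod_cast hq
  have hqN' : (q : ℝ) ≤ N := by exact_mod_cast hqN
  have hG : 0 ≤ ∑ j ∈ range q, g j := sum_nonneg fun j _ => norm_nonneg _
  have h4 : (q : ℝ) ^ 2 * ‖S‖ ^ 2 ≤ (2 * N) * (q * (2 * ∑ j ∈ range q, g j)) :=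
    h2.trans (mul_le_mul (by linarith) h3 (sum_nonneg fun _ _ => by positivity) (by positivity))
  rw [div_mul_eq_mul_div, le_div_iff₀ hq']
  have : q * (‖S‖ ^ 2 * q) ≤ q * (4 * N * ∑ j ∈ range q, g j) := by nlinarith
  exact le_of_mul_le_mul_left this hq'

/-! ### The derivative test for sequences -/

/-- The `k`-th forward differences of `u` at `0, …, N - 1` lie in `[lam, A * lam]` and are
monotone (in either direction). This is the discrete counterpart of a function whose `k`-th
derivative is monotone and of exact order `lam`. -/
def DiffBound (k : ℕ) (A lam : ℝ) (N : ℕ) (u : ℕ → ℝ) : Prop :=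
  (∀ n < N, lam ≤ (fwdDiff 1)^[k] u n ∧ (fwdDiff 1)^[k] u n ≤ A * lam) ∧
    ((∀ n, n + 1 < N → (fwdDiff 1)^[k] u n ≤ (fwdDiff 1)^[k] u (n + 1)) ∨
      (∀ n, n + 1 < N → (fwdDiff 1)^[k] u (n + 1) ≤ (fwdDiff 1)^[k] u n))

lemma fwdDiff_iter_shift_sub (k j : ℕ) (u : ℕ → ℝ) (n : ℕ) :
    (fwdDiff 1)^[k] (fun n => u (n + j) - u n) n =
      ∑ i ∈ range j, (fwdDiff 1)^[k + 1] u (n + i) := by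
  have h1 : (fwdDiff 1)^[k] (fun n => u (n + j) - u n) n =
      (fwdDiff 1)^[k] u (n + j) - (fwdDiff 1)^[k] u n := by
    have := congrFun (fwdDiff_iter_add 1 (fun n => u (n + j)) ((-1 : ℝ) • u) k) n
    rw [fwdDiff_iter_const_smul] at this
    simp only [Pi.add_apply, Pi.smul_apply, smul_eq_mul, neg_mul, one_mul] at this
    rw [← fwdDiff_iter_comp_add, sub_eq_add_neg, ← this]
    have e : (fun n => u (n + j) - u n) = (fun n => u (n + j)) + (-1 : ℝ) • u := by
      funext m; simp [sub_eq_add_neg]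
    rw [e]
  rw [h1]
  simp only [Function.iterate_succ_apply', fwdDiff]
  have := sum_range_sub (fun i => (fwdDiff 1)^[k] u (n + i)) j
  simp only [add_zero] at this
  rw [← this]
  simp only [add_assoc]

/-- Weyl differencing lowers the order by one and multiplies the size by the shift `j`. -/
lemma DiffBound.shift_sub {k : ℕ} {A lam : ℝ} {N : ℕ} {u : ℕ → ℝ}
    (h : DiffBound (k + 1) A lam N u) (j : ℕ) :
    DiffBound k A (j * lam) (N - j) (fun n => u (n + j) - u n) := by
  refine ⟨fun n hn => ?_, ?_⟩
  · rw [fwdDiff_iter_shift_sub]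
    constructor
    · have := card_nsmul_le_sum (range j) (fun i => (fwdDiff 1)^[k + 1] u (n + i)) lam
        fun i hi => (h.1 (n + i) (by rw [mem_range] at hi; omega)).1
      simpa using this
    · have := sum_le_card_nsmul (range j) (fun i => (fwdDiff 1)^[k + 1] u (n + i)) (A * lam)
        fun i hi => (h.1 (n + i) (by rw [mem_range] at hi; omega)).2
      refine this.trans (le_of_eq ?_)
      simp; ring
  · rcases h.2 with h | h
    · left
      intro n hn
      rw [fwdDiff_iter_shift_sub, fwdDiff_iter_shift_sub]
      refine sum_le_sum fun i hi => ?_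
      rw [mem_range] at hi
      rw [show n + 1 + i = n + i + 1 by ring]
      exact h _ (by omega)
    · right
      intro n hn
      rw [fwdDiff_iter_shift_sub, fwdDiff_iter_shift_sub]
      refine sum_le_sum fun i hi => ?_
      rw [mem_range] at hi
      rw [show n + 1 + i = n + i + 1 by ring]
      exact h _ (by omega)

lemma norm_sum_expo_sq_le (u : ℕ → ℝ) {N q : ℕ} (hq : 0 < q) (hqN : q ≤ N) :
    ‖∑ n ∈ range N, expo (u n)‖ ^ 2 ≤ 4 * N / q *
      (N + ∑ j ∈ Ico 1 q, ‖∑ n ∈ range (N - j), expo (u (n + j) - u n)‖) := by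
  refine (vanDerCorput_inequality (fun n => expo (u n)) N q hq hqN).trans ?_
  simp only [conj_expo, ← expo_add, ← sub_eq_add_neg]
  gcongr
  rw [range_eq_Ico, sum_eq_sum_Ico_succ_bot hq]
  gcongr
  simpa using norm_sum_expo_le (fun n => u (n + 0) - u n) (range (N - 0))

/-- A telescoping substitute for `∑ j ^ (a - 1) ≤ ∫ t ^ (a - 1)`, resting on Bernoulli's
inequality. -/
lemma sum_rpow_sub_one_le {a : ℝ} (h0 : 0 < a) (h1 : a ≤ 1) (n : ℕ) :
    ∑ j ∈ Icc 1 n, (j : ℝ) ^ (a - 1) ≤ (n : ℝ) ^ a / a := by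
  induction n with
  | zero => simp [Real.zero_rpow h0.ne']
  | succ n ih =>
    rw [sum_Icc_succ_top (by omega)]
    refine (add_le_add_left ih _).trans ?_
    rw [← le_sub_iff_add_le', ← sub_div, le_div_iff₀ h0]
    have hn : (0 : ℝ) < (n + 1 : ℕ) := by positivity
    have hb := rpow_one_add_le_one_add_mul_self (s := -1 / (n + 1 : ℕ)) (p := a)
      (by rw [le_div_iff₀ hn]; push_cast; linarith) h0.le h1
    have e : (n : ℝ) = (n + 1 : ℕ) * (1 + -1 / (n + 1 : ℕ)) := by
      field_simp; push_cast; ring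
    have e2 : (n : ℝ) ^ a = ((n + 1 : ℕ) : ℝ) ^ a * (1 + -1 / (n + 1 : ℕ)) ^ a := by
      conv_lhs => rw [e]
      rw [Real.mul_rpow hn.le]
      have : (0 : ℝ) ≤ n / (n + 1 : ℕ) := by positivity
      rw [e, mul_div_assoc, mul_div_cancel₀] at this
      · exact this
      · exact hn.ne'
    rw [e2, Real.rpow_sub_one hn.ne']
    have := mul_le_mul_of_nonneg_left hb (Real.rpow_nonneg hn.le a)
    calc _ = ((n + 1 : ℕ) : ℝ) ^ a - ((n + 1 : ℕ) : ℝ) ^ a * (1 + a * (-1 / (n + 1 : ℕ))) := by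
          ring
      _ ≤ _ := by linarith

lemma le_of_sq_le_sum_sq {S K M L a b c : ℝ} (hK : 0 ≤ K) (hM : 0 ≤ M) (hL : 1 ≤ L)
    (ha : 0 ≤ a) (hb : 0 ≤ b) (hc : 0 ≤ c)
    (h : S ^ 2 ≤ K * M ^ 2 * (a ^ 2 + L * (b ^ 2 + c ^ 2))) :
    S ≤ √K * (M * (a + L * (b + c))) := by
  apply le_of_abs_le
  apply abs_le_of_sq_le_sq _ (by positivity)
  refine h.trans ?_
  rw [mul_pow, Real.sq_sqrt hK, mul_pow, ← mul_assoc]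
  gcongr
  have h1 : L * (b ^ 2 + c ^ 2) ≤ L ^ 2 * (b + c) ^ 2 := by
    have : L * (b ^ 2 + c ^ 2) ≤ L ^ 2 * (b ^ 2 + c ^ 2) := by
      gcongr; nlinarith
    refine this.trans ?_
    gcongr
    nlinarith [mul_nonneg hb hc]
  nlinarith [mul_nonneg ha (mul_nonneg (by linarith : (0:ℝ) ≤ L) (add_nonneg hb hc))]

/-- The second-derivative test: the starting point of the induction on the order. -/
lemma norm_sum_expo_le_of_diffBound_two {A : ℝ} (hA : 1 ≤ A) {N : ℕ} (hN : 1 ≤ N) {lam : ℝ}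
    (hlam : 0 < lam) {u : ℕ → ℝ} (h : DiffBound 2 A lam N u) :
    ‖∑ n ∈ range N, expo (u n)‖ ≤ √(32 * A) * (N * (lam ^ (1 / 2 : ℝ) + (1 + Real.log N) *
      ((N : ℝ) ^ (-(1 / 2) : ℝ) + ((N : ℝ) ^ 2 * lam) ^ (-(1 / 2) : ℝ)))) := by
  have hN' : (1 : ℝ) ≤ N := by exact_mod_cast hN
  have hN0 : (0 : ℝ) < N := by linarith
  have hL : 1 ≤ 1 + Real.log N := by have := Real.log_nonneg hN'; linarith
  have sq1 : ∀ t : ℝ, 0 ≤ t → (t ^ (1 / 2 : ℝ)) ^ 2 = t := by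
    intro t ht; rw [← Real.rpow_natCast, ← Real.rpow_mul ht]; norm_num
  have sq2 : ∀ t : ℝ, 0 ≤ t → (t ^ (-(1 / 2) : ℝ)) ^ 2 = 1 / t := by
    intro t ht; rw [← Real.rpow_natCast, ← Real.rpow_mul ht]; norm_num [Real.rpow_neg_one]
  apply le_of_sq_le_sum_sq (by positivity) hN0.le hL (by positivity) (by positivity)
    (by positivity)
  rw [sq1 _ hlam.le, sq2 _ hN0.le, sq2 _ (by positivity)]
  rcases lt_or_ge 1 (2 * A * lam) with hbig | hsmall
  · have h1 : ‖∑ n ∈ range N, expo (u n)‖ ^ 2 ≤ (N : ℝ) ^ 2 := by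
      gcongr; simpa using norm_sum_expo_le u (range N)
    have h2 : lam ≤ lam + (1 + Real.log N) * (1 / N + 1 / (N ^ 2 * lam)) :=
      le_add_of_nonneg_right (by positivity)
    calc _ ≤ (N : ℝ) ^ 2 * 1 := by rw [mul_one]; exact h1
      _ ≤ (N : ℝ) ^ 2 * (32 * A * lam) := by gcongr; linarith
      _ = 32 * A * N ^ 2 * lam := by ring
      _ ≤ _ := by gcongr
  -- Shifts `j ≤ 1 / (2 * A * lam)` keep the differences below `1/2`, as Kusmin–Landau requires.
  · set y : ℝ := min N (1 / (2 * A * lam)) with hy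
    have hy1 : 1 ≤ y := le_min hN' (by rw [le_div_iff₀ (by positivity)]; linarith)
    set q := ⌊y⌋₊ with hq
    have hq1 : 1 ≤ q := Nat.one_le_floor_iff y |>.2 hy1
    have hqy : (q : ℝ) ≤ y := Nat.floor_le (by linarith)
    have hyq : y ≤ 2 * q := by
      have := (Nat.lt_floor_add_one y).le
      have h1 : (1 : ℝ) ≤ q := by exact_mod_cast hq1
      linarith
    have hqN : q ≤ N := by exact_mod_cast hqy.trans (min_le_left _ _)
    have hq0 : (0 : ℝ) < q := by exact_mod_cast hq1
    have hK : ∀ j ∈ Ico 1 q, ‖∑ n ∈ range (N - j), expo (u (n + j) - u n)‖ ≤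
        1 / lam * (j : ℝ)⁻¹ := by
      intro j hj
      rw [mem_Ico] at hj
      have hj0 : (0 : ℝ) < j := by exact_mod_cast hj.1
      have hd := h.shift_sub j
      have hjle : A * (j * lam) ≤ 1 / 2 := by
        have h1 : (j : ℝ) ≤ 1 / (2 * A * lam) :=
          (by exact_mod_cast hj.2.le : (j : ℝ) ≤ q).trans (hqy.trans (min_le_right _ _))
        rw [le_div_iff₀ (by positivity)] at h1
        linarith
      refine (kusmin_landau (u := fun n => u (n + j) - u n) (θ := j * lam) (by positivity)
        (fun n hn => (hd.1 n hn).1) (fun n hn => (hd.1 n hn).2.trans hjle) hd.2).trans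
        (le_of_eq ?_)
      field_simp
    have hsum : ∑ j ∈ Ico 1 q, ‖∑ n ∈ range (N - j), expo (u (n + j) - u n)‖ ≤
        1 / lam * (1 + Real.log N) := by
      refine (sum_le_sum hK).trans ?_
      rw [← mul_sum]
      gcongr
      have h1 := harmonic_le_one_add_log q
      rw [harmonic_eq_sum_Icc] at h1
      push_cast at h1
      refine le_trans ?_ (h1.trans ?_)
      · exact sum_le_sum_of_subset_of_nonneg (fun a ha => by
          rw [mem_Ico] at ha; rw [mem_Icc]; omega) fun _ _ _ => by positivity
      · have : Real.log q ≤ Real.log N := Real.log_le_log hq0 (by exact_mod_cast hqN)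
        linarith
    have hinv : 1 / (q : ℝ) ≤ 2 * (1 / N + 2 * A * lam) := by
      have h1 : 1 / y ≤ 1 / N + 2 * A * lam := by
        rcases min_choice (N : ℝ) (1 / (2 * A * lam)) with h | h <;> rw [hy, h]
        · have : 0 ≤ 2 * A * lam := by positivity
          linarith
        · have : 0 ≤ 1 / (N : ℝ) := by positivity
          rw [one_div_one_div]; linarith
      have h2 : 1 / (q : ℝ) ≤ 2 * (1 / y) := by
        rw [div_le_iff₀ hq0]
        rw [mul_one_div, div_mul_eq_mul_div, le_div_iff₀ (by linarith)]
        linarith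
      linarith
    have hfin := (norm_sum_expo_sq_le u hq1 hqN)
    set L := 1 + Real.log N
    calc _ ≤ 4 * N / q * (N + 1 / lam * L) := hfin.trans (by gcongr)
      _ = 4 * N * (1 / q) * (N + 1 / lam * L) := by ring
      _ ≤ 4 * N * (2 * (1 / N + 2 * A * lam)) * (N + 1 / lam * L) := by gcongr
      _ = 8 * N ^ 2 * (1 / N + 2 * A * lam + L * (1 / (N ^ 2 * lam)) + 2 * A * (L * (1 / N))) := by
        field_simp; ring
      _ ≤ 8 * N ^ 2 * (4 * A * (lam + L * (1 / N + 1 / (N ^ 2 * lam)))) := by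
        gcongr
        have a1 : 1 / (N : ℝ) ≤ L * (1 / N) := le_mul_of_one_le_left (by positivity) hL
        have a2 : L * (1 / (N : ℝ)) ≤ A * (L * (1 / N)) :=
          le_mul_of_one_le_left (by positivity) hA
        have a3 : L * (1 / (N ^ 2 * lam)) ≤ A * (L * (1 / (N ^ 2 * lam))) :=
          le_mul_of_one_le_left (by positivity) hA
        have a4 : 0 ≤ L * (1 / (N ^ 2 * lam)) := by positivity
        have a5 : 0 ≤ A * lam := by positivity
        have a6 : 0 ≤ 1 / (N : ℝ) := by positivity
        have e : 4 * A * (lam + L * (1 / N + 1 / (N ^ 2 * lam))) = 4 * (A * lam) +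
          4 * (A * (L * (1 / N))) + 4 * (A * (L * (1 / (N ^ 2 * lam)))) := by ring
        rw [e]
        linarith
      _ = _ := by ring

lemma two_mul_le_two_pow {m : ℕ} (hm : 1 ≤ m) : 2 * (m : ℝ) ≤ 2 ^ m := by
  have : ∀ m : ℕ, 1 ≤ m → 2 * m ≤ 2 ^ m := by
    intro m hm
    induction m, hm using Nat.le_induction with
    | base => norm_num
    | succ m hm ih => rw [pow_succ]; omega
  exact_mod_cast this m hm

lemma four_le_two_pow {k : ℕ} (hk : 2 ≤ k) : (4 : ℝ) ≤ (2 : ℝ) ^ k := by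
  calc (4 : ℝ) = 2 ^ 2 := by norm_num
    _ ≤ _ := by gcongr; norm_num

/-- The bound of the derivative test increases with the length of the sum, so that it may be applied
to the shorter sums which differencing produces. -/
lemma vdc_bound_mono {k : ℕ} {α β μ : ℝ} (hβ : β ≤ 1) (hkβ : k * β ≤ 1)
    (hμ : 0 < μ) {M N : ℝ} (hM : 1 ≤ M) (hMN : M ≤ N) :
    M * (μ ^ α + (1 + Real.log M) * (M ^ (-β) + (M ^ k * μ) ^ (-β))) ≤
      N * (μ ^ α + (1 + Real.log N) * (N ^ (-β) + (N ^ k * μ) ^ (-β))) := by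
  have key : ∀ t : ℝ, 1 ≤ t → t * (μ ^ α + (1 + Real.log t) * (t ^ (-β) + (t ^ k * μ) ^ (-β))) =
      t * μ ^ α + (1 + Real.log t) * (t ^ (1 - β) + t ^ (1 - k * β) * μ ^ (-β)) := by
    intro t ht
    have ht0 : 0 < t := by linarith
    rw [Real.mul_rpow (by positivity) hμ.le, ← Real.rpow_natCast t k, ← Real.rpow_mul ht0.le,
      sub_eq_add_neg, sub_eq_add_neg, Real.rpow_add ht0, Real.rpow_add ht0, Real.rpow_one, mul_neg]
    ring
  rw [key M hM, key N (hM.trans hMN)]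
  have := Real.log_nonneg hM
  have := Real.log_le_log (by linarith) hMN
  gcongr
  all_goals linarith

/-- Weyl differencing passes from order `k` to order `k + 1`: the exponent `α` of `lam` becomes
`α / (2 + 2 * α)`, and the saving `β` is halved. The hypothesis `β ≤ (k - 1) * α` makes the main term
of order `k` harmless at the differencing length that controls the secondary terms. -/
lemma norm_sum_expo_le_step {k : ℕ} (hk : 2 ≤ k) {A α β C : ℝ} (hα0 : 0 < α)
    (hβ0 : 0 < β) (hβ : β ≤ 1 / 2) (hkβ : k * β ≤ 1) (hab : β ≤ (k - 1) * α) (hC : 0 ≤ C)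
    (ih : ∀ N : ℕ, 1 ≤ N → ∀ lam : ℝ, 0 < lam → ∀ u : ℕ → ℝ, DiffBound k A lam N u →
      ‖∑ n ∈ range N, expo (u n)‖ ≤ C * (N * (lam ^ α + (1 + Real.log N) *
        ((N : ℝ) ^ (-β) + ((N : ℝ) ^ k * lam) ^ (-β)))))
    {N : ℕ} (hN : 1 ≤ N) {lam : ℝ} (hlam : 0 < lam) {u : ℕ → ℝ} (h : DiffBound (k + 1) A lam N u) :
    ‖∑ n ∈ range N, expo (u n)‖ ≤ √(4 * (2 + 10 * C)) * (N * (lam ^ (α / (2 + 2 * α)) +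
      (1 + Real.log N) * ((N : ℝ) ^ (-(β / 2)) + ((N : ℝ) ^ (k + 1) * lam) ^ (-(β / 2))))) := by
  have hN' : (1 : ℝ) ≤ N := by exact_mod_cast hN
  have hN0 : (0 : ℝ) < N := by linarith
  have hL : 1 ≤ 1 + Real.log N := by have := Real.log_nonneg hN'; linarith
  set γ := α / (2 + 2 * α) with hγ
  have hγ0 : 0 < γ := by positivity
  have sq2 : ∀ t b : ℝ, 0 ≤ t → (t ^ (-(b / 2))) ^ 2 = t ^ (-b) := by
    intro t b ht; rw [← Real.rpow_natCast, ← Real.rpow_mul ht]; congr 1; push_cast; ring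
  have sq1 : (lam ^ γ) ^ 2 = lam ^ (2 * γ) := by
    rw [← Real.rpow_natCast, ← Real.rpow_mul hlam.le]; congr 1; push_cast; ring
  apply le_of_sq_le_sum_sq (by positivity) hN0.le hL (by positivity) (by positivity)
    (by positivity)
  rw [sq1, sq2 _ _ hN0.le, sq2 _ _ (by positivity)]
  rcases le_or_gt 1 lam with hbig | hsmall
  · have h1 : ‖∑ n ∈ range N, expo (u n)‖ ^ 2 ≤ (N : ℝ) ^ 2 := by
      gcongr; simpa using norm_sum_expo_le u (range N)
    have h2 : 1 ≤ lam ^ (2 * γ) := Real.one_le_rpow hbig (by positivity)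
    have h3 : 0 ≤ (1 + Real.log N) *
      ((N : ℝ) ^ (-β) + ((N : ℝ) ^ (k + 1) * lam) ^ (-β)) := by positivity
    calc _ ≤ 1 * (N : ℝ) ^ 2 * 1 := by rw [mul_one, one_mul]; exact h1
      _ ≤ _ := by gcongr <;> linarith
  -- The differencing length `y` balances the diagonal term `1 / y` against the other terms.
  set w : ℝ := 1 / (lam * N ^ (k - 1)) with hw
  have hw0 : 0 < w := by positivity
  set y : ℝ := min N (max (lam ^ (-(2 * γ))) w) with hy
  have hlg : 1 ≤ lam ^ (-(2 * γ)) :=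
    Real.one_le_rpow_of_pos_of_le_one_of_nonpos hlam hsmall.le (by linarith)
  have hy1 : 1 ≤ y := le_min hN' (le_max_of_le_left hlg)
  have hy0 : 0 < y := by linarith
  set q := ⌊y⌋₊ with hq
  have hq1 : 1 ≤ q := Nat.one_le_floor_iff y |>.2 hy1
  have hqy : (q : ℝ) ≤ y := Nat.floor_le (by linarith)
  have hyq : y / 2 ≤ q := by
    have := (Nat.lt_floor_add_one y).le
    have h1 : (1 : ℝ) ≤ q := by exact_mod_cast hq1
    linarith
  have hqN : q ≤ N := by exact_mod_cast hqy.trans (min_le_left _ _)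
  have hq0 : (0 : ℝ) < q := by exact_mod_cast hq1
  set L := 1 + Real.log N with hLdef
  set P := (N : ℝ) ^ k * lam with hP
  have hP0 : 0 < P := by positivity
  have hsum : ∑ j ∈ Ico 1 q, ‖∑ n ∈ range (N - j), expo (u (n + j) - u n)‖ ≤
      C * (N * (q * (q * lam) ^ α + L * (q * (N : ℝ) ^ (-β) + 2 * (q * (q * P) ^ (-β))))) := by
    have hK : ∀ j ∈ Ico 1 q, ‖∑ n ∈ range (N - j), expo (u (n + j) - u n)‖ ≤
        C * (N * ((q * lam) ^ α + L * ((N : ℝ) ^ (-β) + (j : ℝ) ^ (-β) * P ^ (-β)))) := by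
      intro j hj
      rw [mem_Ico] at hj
      have hj0 : (0 : ℝ) < j := by exact_mod_cast hj.1
      have hd := h.shift_sub j
      refine (ih (N - j) (by omega) (j * lam) (by positivity) _ hd).trans ?_
      gcongr ?_ * ?_
      refine (vdc_bound_mono (by linarith) hkβ (by positivity)
        (by exact_mod_cast (by omega : 1 ≤ N - j))
        (by exact_mod_cast Nat.sub_le N j : ((N - j : ℕ) : ℝ) ≤ N)).trans ?_
      rw [← Real.mul_rpow hj0.le hP0.le, show (N : ℝ) ^ k * (j * lam) = j * P by rw [hP]; ring]
      have : (j : ℝ) ≤ q := by exact_mod_cast hj.2.le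
      gcongr
    have hs : ∑ j ∈ Ico 1 q, (j : ℝ) ^ (-β) ≤ 2 * (q * (q : ℝ) ^ (-β)) := by
      have h1 := sum_rpow_sub_one_le (a := 1 - β) (by linarith) (by linarith) q
      rw [show 1 - β - 1 = -β by ring] at h1
      refine le_trans (sum_le_sum_of_subset_of_nonneg (fun a ha => by
          rw [mem_Ico] at ha; rw [mem_Icc]; omega) fun _ _ _ => by positivity)
          (h1.trans ?_)
      rw [sub_eq_add_neg, Real.rpow_add hq0, Real.rpow_one, div_le_iff₀ (by linarith)]
      have : 0 ≤ (q : ℝ) * (q : ℝ) ^ (-β) := by positivity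
      nlinarith
    refine (sum_le_sum hK).trans ?_
    rw [← mul_sum, ← mul_sum, sum_add_distrib, ← mul_sum, sum_add_distrib, ← sum_mul]
    simp only [sum_const, Nat.card_Ico, nsmul_eq_mul]
    have hq' : ((q - 1 : ℕ) : ℝ) ≤ q := by exact_mod_cast Nat.sub_le q 1
    rw [Real.mul_rpow hq0.le hP0.le]
    have e : 2 * ((q : ℝ) * ((q : ℝ) ^ (-β) * P ^ (-β))) =
      2 * ((q : ℝ) * (q : ℝ) ^ (-β)) * P ^ (-β) := by ring
    rw [e]
    gcongr
  have hinv : 1 / (q : ℝ) ≤ 2 * ((N : ℝ) ^ (-β) + lam ^ (2 * γ)) := by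
    have h1 : 1 / y ≤ (N : ℝ) ^ (-β) + lam ^ (2 * γ) := by
      have h2 : min (N : ℝ) (lam ^ (-(2 * γ))) ≤ y := min_le_min_left _ (le_max_left _ _)
      rcases min_choice (N : ℝ) (lam ^ (-(2 * γ))) with h | h <;> rw [h] at h2
      · have h3 : 1 / y ≤ 1 / (N : ℝ) := one_div_le_one_div_of_le hN0 h2
        have h4 : 1 / (N : ℝ) = (N : ℝ) ^ (-1 : ℝ) := by rw [Real.rpow_neg_one, one_div]
        have h5 : (N : ℝ) ^ (-1 : ℝ) ≤ (N : ℝ) ^ (-β) :=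
          Real.rpow_le_rpow_of_exponent_le hN' (by linarith)
        have : 0 ≤ lam ^ (2 * γ) := by positivity
        linarith
      · have h3 : 1 / y ≤ 1 / lam ^ (-(2 * γ)) := one_div_le_one_div_of_le (by positivity) h2
        rw [Real.rpow_neg hlam.le, one_div, one_div, inv_inv] at h3
        have : 0 ≤ (N : ℝ) ^ (-β) := by positivity
        rw [one_div]
        linarith
    have h2 : 1 / (q : ℝ) ≤ 2 * (1 / y) := by
      rw [div_le_iff₀ hq0, mul_one_div, div_mul_eq_mul_div, le_div_iff₀ hy0]
      linarith
    linarith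
  have hmain : (q * lam) ^ α ≤ lam ^ (2 * γ) + (N : ℝ) ^ (-β) := by
    have h1 : q * lam ≤ max (lam ^ (-(2 * γ))) w * lam := by
      gcongr; exact hqy.trans (min_le_right _ _)
    have h2 := Real.rpow_le_rpow (by positivity) h1 hα0.le
    refine h2.trans ?_
    rcases max_choice (lam ^ (-(2 * γ))) w with h | h <;> rw [h]
    · have : (lam ^ (-(2 * γ)) * lam) ^ α = lam ^ (2 * γ) := by
        rw [← Real.rpow_add_one hlam.ne', ← Real.rpow_mul hlam.le]
        congr 1
        rw [hγ]; field_simp; ring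
      rw [this]
      have : 0 ≤ (N : ℝ) ^ (-β) := by positivity
      linarith
    · have : (w * lam) ^ α = (N : ℝ) ^ (-((k - 1) * α)) := by
        rw [show w * lam = ((N : ℝ) ^ (k - 1))⁻¹ by rw [hw]; field_simp,
          ← Real.rpow_natCast, ← Real.rpow_neg hN0.le, ← Real.rpow_mul hN0.le,
          Nat.cast_sub (by omega)]
        congr 1; push_cast; ring
      rw [this]
      have h3 : (N : ℝ) ^ (-((k - 1) * α)) ≤ (N : ℝ) ^ (-β) :=
        Real.rpow_le_rpow_of_exponent_le hN' (by linarith)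
      have : 0 ≤ lam ^ (2 * γ) := by positivity
      linarith
  have hthird : (q * P) ^ (-β) ≤ 2 * (((N : ℝ) ^ (k + 1) * lam) ^ (-β) + (N : ℝ) ^ (-β)) := by
    have h2 : min (N : ℝ) w ≤ y := min_le_min_left _ (le_max_right _ _)
    have h3 : (q * P) ^ (-β) ≤ (1 / 2 * (min (N : ℝ) w * P)) ^ (-β) := by
      apply Real.rpow_le_rpow_of_nonpos (by positivity) _ (by linarith)
      have : 1 / 2 * (min (N : ℝ) w * P) = (min (N : ℝ) w / 2) * P := by ring
      rw [this]; gcongr; linarith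
    rw [Real.mul_rpow (x := 1 / 2) (by norm_num) (by positivity)] at h3
    have h4 : (1 / 2 : ℝ) ^ (-β) ≤ 2 := by
      have := Real.rpow_le_rpow_of_exponent_ge (x := 1 / 2) (by norm_num) (by norm_num)
        (by linarith : (-1 : ℝ) ≤ -β)
      rw [Real.rpow_neg_one] at this
      norm_num at this ⊢; exact this
    refine h3.trans ?_
    gcongr
    rcases min_choice (N : ℝ) w with h | h <;> rw [h]
    · rw [show (N : ℝ) * P = (N : ℝ) ^ (k + 1) * lam by rw [hP]; ring]
      have : 0 ≤ (N : ℝ) ^ (-β) := by positivity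
      linarith
    · have : w * P = N := by
        rw [hw, hP]
        obtain ⟨m, rfl⟩ : ∃ m, k = m + 1 := ⟨k - 1, by omega⟩
        rw [Nat.add_sub_cancel, pow_succ]; field_simp
      rw [this]
      have : 0 ≤ ((N : ℝ) ^ (k + 1) * lam) ^ (-β) := by positivity
      linarith
  have hfin := (norm_sum_expo_sq_le u hq1 hqN)
  calc _ ≤ 4 * N / q * (N + C * (N * (q * (q * lam) ^ α +
        L * (q * (N : ℝ) ^ (-β) + 2 * (q * (q * P) ^ (-β)))))) := hfin.trans (by gcongr)
    _ = 4 * N ^ 2 * (1 / q + C * ((q * lam) ^ α + L * ((N : ℝ) ^ (-β) +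
          2 * (q * P) ^ (-β)))) := by
      field_simp
    _ ≤ 4 * N ^ 2 * (2 * ((N : ℝ) ^ (-β) + lam ^ (2 * γ)) + C * ((lam ^ (2 * γ) + (N : ℝ) ^ (-β)) +
          L * ((N : ℝ) ^ (-β) +
          2 * (2 * (((N : ℝ) ^ (k + 1) * lam) ^ (-β) + (N : ℝ) ^ (-β)))))) := by
      gcongr
    _ ≤ 4 * N ^ 2 * ((2 + 10 * C) * (lam ^ (2 * γ) + L * ((N : ℝ) ^ (-β) +
          ((N : ℝ) ^ (k + 1) * lam) ^ (-β)))) := by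
      gcongr
      set a := lam ^ (2 * γ)
      set b := (N : ℝ) ^ (-β)
      set d := ((N : ℝ) ^ (k + 1) * lam) ^ (-β)
      have ha : 0 ≤ a := by positivity
      have hb : 0 ≤ b := by positivity
      have hd : 0 ≤ L * d := by positivity
      have hbL : b ≤ L * b := le_mul_of_one_le_left hb hL
      have c1 := mul_nonneg hC ha
      have c2 := mul_nonneg hC hd
      have c3 := mul_le_mul_of_nonneg_left hbL hC
      have c4 := mul_nonneg hC hb
      nlinarith
    _ = _ := by ring

/-- The van der Corput `k`-th derivative test in discrete form. The last term, which matters only for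
`lam` below `N ^ (1 - k)`, has the factor `N ^ k * lam` because differencing lengths up to `N` are
allowed at each stage. -/
theorem exists_norm_sum_expo_le {A : ℝ} (hA : 1 ≤ A) {k : ℕ} (hk : 2 ≤ k) :
    ∃ C : ℝ, 0 ≤ C ∧ ∀ N : ℕ, 1 ≤ N → ∀ lam : ℝ, 0 < lam → ∀ u : ℕ → ℝ, DiffBound k A lam N u →
      ‖∑ n ∈ range N, expo (u n)‖ ≤ C * (N * (lam ^ (1 / ((2 : ℝ) ^ k - 2)) + (1 + Real.log N) *
        ((N : ℝ) ^ (-(2 / (2 : ℝ) ^ k)) + ((N : ℝ) ^ k * lam) ^ (-(2 / (2 : ℝ) ^ k))))) := by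
  induction k, hk using Nat.le_induction with
  | base =>
    refine ⟨√(32 * A), by positivity, fun N hN lam hlam u h => ?_⟩
    convert norm_sum_expo_le_of_diffBound_two hA hN hlam h using 8 <;> norm_num
  | succ k hk ih =>
    obtain ⟨C, hC, ih⟩ := ih
    have h4 := four_le_two_pow hk
    have hlin := two_mul_le_two_pow (by omega : 1 ≤ k)
    have hk' : (2 : ℝ) ≤ k := by exact_mod_cast hk
    refine ⟨√(4 * (2 + 10 * C)), by positivity, fun N hN lam hlam u h => ?_⟩
    have := norm_sum_expo_le_step hk (α := 1 / ((2 : ℝ) ^ k - 2)) (β := 2 / (2 : ℝ) ^ k)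
      (by apply one_div_pos.2; linarith) (by positivity)
      (by rw [div_le_iff₀ (by linarith)]; linarith)
      (by rw [mul_div_assoc', div_le_iff₀ (by linarith)]; linarith)
      (by
        rw [mul_one_div, div_le_div_iff₀ (by linarith) (by linarith)]
        rcases hk.eq_or_lt with rfl | hk3
        · norm_num
        · have : (3 : ℝ) ≤ k := by exact_mod_cast hk3
          nlinarith) hC ih hN hlam h
    have e1 : 1 / ((2 : ℝ) ^ k - 2) / (2 + 2 * (1 / ((2 : ℝ) ^ k - 2))) =
        1 / ((2 : ℝ) ^ (k + 1) - 2) := by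
      have : (2 : ℝ) ^ k - 2 ≠ 0 := by linarith
      have h5 : (2 : ℝ) ^ (k + 1) - 2 ≠ 0 := by rw [pow_succ]; linarith
      rw [pow_succ] at h5 ⊢
      field_simp
      rw [div_eq_div_iff (by intro h; apply h5; linarith) (by intro h; apply h5; linarith)]
      ring
    have e2 : 2 / (2 : ℝ) ^ k / 2 = 2 / (2 : ℝ) ^ (k + 1) := by rw [pow_succ]; field_simp
    rw [e1, e2] at this
    exact this

/-! ### The sawtooth function and equidistribution modulo one -/

/-- The sawtooth function `{t} - 1/2`. -/
noncomputable def sawtooth (t : ℝ) : ℝ := Int.fract t - 1 / 2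

/-- The second periodic Bernoulli function `{t}² - {t} + 1/6`. -/
noncomputable def periodicBernoulliTwo (t : ℝ) : ℝ := Int.fract t ^ 2 - Int.fract t + 1 / 6

lemma hasSum_periodicBernoulliTwo (t : ℝ) :
    HasSum (fun n : ℕ => 1 / (n : ℝ) ^ 2 * Real.cos (2 * Real.pi * n * t))
      (Real.pi ^ 2 * periodicBernoulliTwo t) := by
  have h := hasSum_one_div_nat_pow_mul_cos (k := 1) one_ne_zero
    (x := Int.fract t) ⟨Int.fract_nonneg t, (Int.fract_lt_one t).le⟩
  convert h using 1
  · funext n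
    simp only [mul_one]
    congr 1
    conv_lhs => rw [← Int.fract_add_floor t]
    rw [mul_add, show 2 * Real.pi * n * (⌊t⌋ : ℝ) = ((n * ⌊t⌋ : ℤ) : ℝ) * (2 * Real.pi) by
      push_cast; ring, Real.cos_add_int_mul_two_pi]
  · have := bernoulliFun_two (Int.fract t)
    unfold bernoulliFun at this
    rw [mul_one, this]
    simp only [periodicBernoulliTwo, mul_one, Nat.factorial]
    push_cast
    ring

lemma fract_add_cases (t D : ℝ) (h0 : 0 ≤ D) (h1 : D < 1) :
    (Int.fract (t + D) = Int.fract t + D) ∨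
      (Int.fract (t + D) = Int.fract t + D - 1 ∧ 1 ≤ Int.fract t + D) := by
  have hf0 := Int.fract_nonneg t
  have hf1 := Int.fract_lt_one t
  have e : t + D = (Int.fract t + D) + (⌊t⌋ : ℤ) := by
    have := Int.fract_add_floor t
    linarith
  rcases lt_or_ge (Int.fract t + D) 1 with h | h
  · left
    rw [e, Int.fract_add_intCast, Int.fract_eq_self.2 ⟨by linarith, h⟩]
  · right
    refine ⟨?_, h⟩
    have e2 : t + D = (Int.fract t + D - 1) + ((⌊t⌋ + 1 : ℤ) : ℝ) := by push_cast; linarith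
    rw [e2, Int.fract_add_intCast]
    apply Int.fract_eq_self.2 ⟨by linarith, by linarith⟩

/-- The sawtooth has slope one and jumps downwards, so its mean over `[t, t + D]` is at most
`sawtooth t + D / 2`; half the difference of `periodicBernoulliTwo` is the integral of the sawtooth. -/
lemma periodicBernoulliTwo_add_sub_le (t : ℝ) {D : ℝ} (h0 : 0 ≤ D) (h1 : D < 1) :
    periodicBernoulliTwo (t + D) - periodicBernoulliTwo t ≤ 2 * D * sawtooth t + D ^ 2 := by
  unfold periodicBernoulliTwo sawtooth
  rcases fract_add_cases t D h0 h1 with h | ⟨h, h2⟩ <;> rw [h] <;> nlinarith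

lemma le_periodicBernoulliTwo_add_sub (t : ℝ) {D : ℝ} (h0 : 0 ≤ D) (h1 : D < 1) :
    2 * D * sawtooth (t + D) - D ^ 2 ≤ periodicBernoulliTwo (t + D) - periodicBernoulliTwo t := by
  unfold periodicBernoulliTwo sawtooth
  rcases fract_add_cases t D h0 h1 with h | ⟨h, h2⟩ <;> rw [h] <;>
    nlinarith [Int.fract_lt_one t, Int.fract_nonneg t]

lemma abs_sum_cos_sub_cos_le (y : ℕ → ℝ) (N h : ℕ) (D : ℝ) :
    |∑ n ∈ range N, (Real.cos (2 * Real.pi * h * (y n + D)) - Real.cos (2 * Real.pi * h * y n))| ≤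
      2 * |Real.sin (Real.pi * (h * D))| * ‖∑ n ∈ range N, expo (h * y n)‖ := by
  have hre : ∀ t : ℝ, Real.cos (2 * Real.pi * h * t) = (expo (h * t)).re := by
    intro t
    unfold expo
    rw [mul_comm Complex.I, Complex.exp_ofReal_mul_I_re]
    ring_nf
  have : ∑ n ∈ range N,
      (Real.cos (2 * Real.pi * h * (y n + D)) - Real.cos (2 * Real.pi * h * y n)) =
      ((expo (h * D) - 1) * ∑ n ∈ range N, expo (h * y n)).re := by
    rw [mul_sum, Complex.re_sum]
    apply sum_congr rfl
    intro n _
    rw [hre, hre, ← Complex.sub_re, mul_add, expo_add]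
    congr 1; ring
  rw [this]
  refine (Complex.abs_re_le_norm _).trans ?_
  rw [norm_mul, norm_expo_sub_one]

/-- Shifting the second periodic Bernoulli function by `±1/H` produces a sum that is controlled by
its Fourier series. -/
lemma abs_sum_periodicBernoulliTwo_sub_le {y : ℕ → ℝ} {N H : ℕ} (hH : 0 < H) {T : ℝ}
    (hT : ∀ M : ℕ, ∑ h ∈ Icc 1 M, 1 / (h : ℝ) ^ 2 * min 1 ((h : ℝ) / H) *
      ‖∑ n ∈ range N, expo (h * y n)‖ ≤ T) {D : ℝ} (hD : |D| = 1 / H) :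
    |∑ n ∈ range N, (periodicBernoulliTwo (y n + D) - periodicBernoulliTwo (y n))| ≤ T := by
  have hH0 : (0 : ℝ) < H := by exact_mod_cast hH
  have hs : HasSum (fun h : ℕ => 1 / (h : ℝ) ^ 2 * ∑ n ∈ range N,
      (Real.cos (2 * Real.pi * h * (y n + D)) - Real.cos (2 * Real.pi * h * y n)))
      (Real.pi ^ 2 * ∑ n ∈ range N,
        (periodicBernoulliTwo (y n + D) - periodicBernoulliTwo (y n))) := by
    simp only [mul_sum]
    apply hasSum_sum
    intro n _
    simp only [mul_sub]
    exact (hasSum_periodicBernoulliTwo _).sub (hasSum_periodicBernoulliTwo _)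
  have ht := hs.tendsto_sum_nat.abs
  have hle : |Real.pi ^ 2 * ∑ n ∈ range N,
      (periodicBernoulliTwo (y n + D) - periodicBernoulliTwo (y n))| ≤ 2 * Real.pi * T := by
    refine le_of_tendsto ht (Filter.Eventually.of_forall fun M => ?_)
    refine (abs_sum_le_sum_abs _ _).trans ?_
    have hpi : (1 : ℝ) ≤ Real.pi := by linarith [Real.pi_gt_three]
    calc _ ≤ ∑ h ∈ range M, 2 * Real.pi * (1 / (h : ℝ) ^ 2 * min 1 ((h : ℝ) / H) *
          ‖∑ n ∈ range N, expo (h * y n)‖) := by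
          refine sum_le_sum fun h _ => ?_
          rw [abs_mul, abs_of_nonneg (by positivity)]
          have h1 : 2 * |Real.sin (Real.pi * (h * D))| ≤ 2 * Real.pi * min 1 ((h : ℝ) / H) := by
            rcases min_choice (1 : ℝ) ((h : ℝ) / H) with h' | h' <;> rw [h']
            · have := Real.abs_sin_le_one (Real.pi * (h * D)); linarith
            · have : |Real.sin (Real.pi * (h * D))| ≤ |Real.pi * (h * D)| := Real.abs_sin_le_abs
              rw [abs_mul, abs_mul, hD, abs_of_pos Real.pi_pos, Nat.abs_cast] at this
              calc _ ≤ 2 * (Real.pi * (h * (1 / H))) := by linarith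
                _ = _ := by ring
          have h2 := (abs_sum_cos_sub_cos_le y N h D).trans
            (mul_le_mul_of_nonneg_right h1 (norm_nonneg _))
          calc _ ≤ 1 / (h : ℝ) ^ 2 * (2 * Real.pi * min 1 ((h : ℝ) / H) *
                ‖∑ n ∈ range N, expo (h * y n)‖) := by gcongr
            _ = _ := by ring
      _ = 2 * Real.pi * ∑ h ∈ range M, (1 / (h : ℝ) ^ 2 * min 1 ((h : ℝ) / H) *
          ‖∑ n ∈ range N, expo (h * y n)‖) := by rw [mul_sum]
      _ ≤ 2 * Real.pi * ∑ h ∈ Icc 1 M, (1 / (h : ℝ) ^ 2 * min 1 ((h : ℝ) / H) *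
          ‖∑ n ∈ range N, expo (h * y n)‖) := by
          gcongr 2 * Real.pi * ?_
          rw [← sum_subset (s₁ := (range M).filter (· ≠ 0)) (filter_subset _ _)]
          · apply sum_le_sum_of_subset_of_nonneg
            · intro a ha; simp only [mem_filter, mem_range, mem_Icc] at ha ⊢; omega
            · intro _ _ _; positivity
          · intro a ha ha'
            have : a = 0 := by simp only [mem_filter, not_and, not_not] at ha'; exact ha' ha
            simp [this]
      _ ≤ 2 * Real.pi * T := by gcongr; exact hT M
  rw [abs_mul, abs_of_nonneg (by positivity)] at hle
  have hT0 : 0 ≤ T := by simpa using hT 0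
  have hpi := Real.pi_gt_three
  set X := |∑ n ∈ range N, (periodicBernoulliTwo (y n + D) - periodicBernoulliTwo (y n))|
  have : Real.pi * (Real.pi * X) ≤ Real.pi * (2 * T) := by nlinarith
  have := le_of_mul_le_mul_left this Real.pi_pos
  have hX : 0 ≤ X := abs_nonneg _
  nlinarith

/-- An Erdős–Turán type bound for sums of the sawtooth function. -/
theorem abs_sum_sawtooth_le {y : ℕ → ℝ} {N H : ℕ} (hH : 1 < H) {T : ℝ}
    (hT : ∀ M : ℕ, ∑ h ∈ Icc 1 M, 1 / (h : ℝ) ^ 2 * min 1 ((h : ℝ) / H) *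
      ‖∑ n ∈ range N, expo (h * y n)‖ ≤ T) :
    |∑ n ∈ range N, sawtooth (y n)| ≤ N / H + H * T := by
  have hH1 : (1 : ℝ) < H := by exact_mod_cast hH
  have hH0 : (0 : ℝ) < H := by linarith
  set D : ℝ := 1 / H with hD
  have hD0 : 0 < D := by positivity
  have hD1 : D < 1 := by rw [hD, div_lt_one hH0]; exact hH1
  have hDH : D * H = 1 := by rw [hD]; field_simp
  have hu := abs_sum_periodicBernoulliTwo_sub_le (by omega) hT (D := D) (abs_of_pos hD0)
  have hl := abs_sum_periodicBernoulliTwo_sub_le (by omega) hT (D := -D)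
    (by rw [abs_neg]; exact abs_of_pos hD0)
  have h1 : ∑ n ∈ range N, (periodicBernoulliTwo (y n + D) - periodicBernoulliTwo (y n)) ≤
      2 * D * ∑ n ∈ range N, sawtooth (y n) + N * D ^ 2 := by
    rw [mul_sum]
    have : (N : ℝ) * D ^ 2 = ∑ n ∈ range N, D ^ 2 := by simp
    rw [this, ← sum_add_distrib]
    exact sum_le_sum fun n _ => periodicBernoulliTwo_add_sub_le _ hD0.le hD1
  have h2 : 2 * D * ∑ n ∈ range N, sawtooth (y n) - N * D ^ 2 ≤
      -∑ n ∈ range N, (periodicBernoulliTwo (y n + -D) - periodicBernoulliTwo (y n)) := by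
    rw [mul_sum]
    have : (N : ℝ) * D ^ 2 = ∑ n ∈ range N, D ^ 2 := by simp
    rw [this, ← sum_sub_distrib, ← sum_neg_distrib]
    refine sum_le_sum fun n _ => ?_
    have := le_periodicBernoulliTwo_add_sub (y n + -D) hD0.le hD1
    rw [neg_add_cancel_right] at this
    linarith
  set X := ∑ n ∈ range N, sawtooth (y n)
  have hT0 : 0 ≤ T := by simpa using hT 0
  have h3 : |2 * D * X| ≤ T + N * D ^ 2 := by
    rw [abs_le] at hu hl ⊢
    constructor <;> linarith
  rw [abs_mul, abs_of_pos (by positivity)] at h3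
  have h4 : |X| * (2 * D * H) ≤ H * T + N * D * (D * H) := by nlinarith
  rw [mul_assoc 2 D H, hDH, mul_one, mul_one] at h4
  have h5 : (N : ℝ) / H = N * D := by rw [hD]; ring
  rw [h5]
  have : 0 ≤ N * D := by positivity
  have : 0 ≤ H * T := by positivity
  linarith

/-- A telescoping substitute for `∑ j ^ (-1 - a) ≤ ∫ t ^ (-1 - a)` over a tail. -/
lemma sum_Ioc_rpow_le {a : ℝ} (ha : 0 < a) {H : ℕ} (hH : 0 < H) (M : ℕ) :
    ∑ j ∈ Ioc H M, (j : ℝ) ^ (-1 - a) ≤ (H : ℝ) ^ (-a) / a := by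
  have key : ∀ M, H ≤ M → ∑ j ∈ Ioc H M, (j : ℝ) ^ (-1 - a) ≤
      ((H : ℝ) ^ (-a) - (M : ℝ) ^ (-a)) / a := by
    intro M hM
    induction M, hM using Nat.le_induction with
    | base => simp
    | succ n hn ih =>
      rw [← insert_Ioc_right_eq_Ioc_add_one hn, sum_insert (by simp), add_comm]
      refine (add_le_add_left ih _).trans ?_
      rw [← le_sub_iff_add_le', ← sub_div, le_div_iff₀ ha]
      have hn0 : (0 : ℝ) < n := by exact_mod_cast (by omega : 0 < n)
      have hn1 : (0 : ℝ) < (n + 1 : ℕ) := by positivity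
      have hb : 1 + a * (1 / (n + 1 : ℕ)) ≤ ((n : ℝ) / (n + 1 : ℕ)) ^ (-a) := by
        rw [Real.rpow_def_of_pos (by positivity)]
        have h1 := Real.log_le_sub_one_of_pos (x := (n : ℝ) / (n + 1 : ℕ)) (by positivity)
        have h2 : (n : ℝ) / (n + 1 : ℕ) - 1 = -(1 / (n + 1 : ℕ)) := by
          field_simp; push_cast; ring
        have h3 := Real.add_one_le_exp (Real.log ((n : ℝ) / (n + 1 : ℕ)) * -a)
        rw [h2] at h1
        nlinarith
      rw [Real.div_rpow hn0.le hn1.le, le_div_iff₀ (by positivity)] at hb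
      have e : ((n + 1 : ℕ) : ℝ) ^ (-1 - a) = ((n + 1 : ℕ) : ℝ) ^ (-a) * (1 / (n + 1 : ℕ)) := by
        rw [show -1 - a = -a - 1 by ring, Real.rpow_sub_one hn1.ne']; ring
      rw [e]
      linarith
  rcases le_total H M with h | h
  · refine (key M h).trans ?_
    gcongr
    have : (0 : ℝ) ≤ (M : ℝ) ^ (-a) := by positivity
    linarith
  · rw [Ioc_eq_empty (by omega), sum_empty]; positivity

/-- The Fourier weights `min 1 (h / H) / h ^ 2` against `h ^ a`, without a logarithmic loss. -/
lemma sum_kernel_le {a : ℝ} (h0 : 0 < a) (h1 : a ≤ 1 / 2) {H : ℕ} (hH : 0 < H) (M : ℕ) :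
    ∑ h ∈ Icc 1 M, 1 / (h : ℝ) ^ 2 * min 1 ((h : ℝ) / H) * (h : ℝ) ^ a ≤
      (1 / a + 2) * (H : ℝ) ^ (a - 1) := by
  have hH0 : (0 : ℝ) < H := by exact_mod_cast hH
  rw [← sum_filter_add_sum_filter_not _ (fun h => h ≤ H), add_mul]
  apply add_le_add
  · calc _ ≤ ∑ h ∈ (Icc 1 M).filter (fun h => h ≤ H), 1 / (H : ℝ) * (h : ℝ) ^ (a - 1) := by
          refine sum_le_sum fun h hh => ?_
          simp only [mem_filter, mem_Icc] at hh
          have hh0 : (0 : ℝ) < h := by exact_mod_cast hh.1.1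
          rw [Real.rpow_sub_one hh0.ne']
          calc _ ≤ 1 / (h : ℝ) ^ 2 * ((h : ℝ) / H) * (h : ℝ) ^ a := by
                gcongr; exact min_le_right _ _
            _ = _ := by field_simp
      _ ≤ ∑ h ∈ Icc 1 H, 1 / (H : ℝ) * (h : ℝ) ^ (a - 1) := by
          apply sum_le_sum_of_subset_of_nonneg
          · intro x hx; simp only [mem_filter, mem_Icc] at hx ⊢; omega
          · intro _ _ _; positivity
      _ ≤ 1 / (H : ℝ) * ((H : ℝ) ^ a / a) := by
          rw [← mul_sum]; gcongr; exact sum_rpow_sub_one_le h0 (by linarith) H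
      _ = _ := by rw [Real.rpow_sub_one hH0.ne']; ring
  · calc _ ≤ ∑ h ∈ (Icc 1 M).filter (fun h => ¬ h ≤ H), (h : ℝ) ^ (-1 - (1 - a)) := by
          refine sum_le_sum fun h hh => ?_
          simp only [mem_filter, mem_Icc] at hh
          have hh0 : (0 : ℝ) < h := by exact_mod_cast hh.1.1
          rw [show -1 - (1 - a) = a - (2 : ℕ) by push_cast; ring, Real.rpow_sub_natCast hh0.ne']
          calc _ ≤ 1 / (h : ℝ) ^ 2 * 1 * (h : ℝ) ^ a := by
                gcongr; exact min_le_left _ _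
            _ = _ := by ring
      _ ≤ ∑ h ∈ Ioc H M, (h : ℝ) ^ (-1 - (1 - a)) := by
          apply sum_le_sum_of_subset_of_nonneg
          · intro x hx; simp only [mem_filter, mem_Icc, mem_Ioc] at hx ⊢; omega
          · intro _ _ _; positivity
      _ ≤ (H : ℝ) ^ (-(1 - a)) / (1 - a) := sum_Ioc_rpow_le (by linarith) hH M
      _ ≤ _ := by
          rw [div_le_iff₀ (by linarith), neg_sub]
          have : (0 : ℝ) ≤ (H : ℝ) ^ (a - 1) := by positivity
          nlinarith

/-- The sawtooth bound, for exponential sums of frequency `h` bounded by `V * h ^ a + W`. -/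
lemma abs_sum_sawtooth_le_of_bound {y : ℕ → ℝ} {N H : ℕ} (hH : 1 < H) {a ε V W : ℝ}
    (ha0 : 0 < a) (ha1 : a ≤ 1 / 2) (hε0 : 0 < ε) (hε1 : ε ≤ 1 / 2) (hV : 0 ≤ V) (hW : 0 ≤ W)
    (hy : ∀ h : ℕ, 1 ≤ h → ‖∑ n ∈ range N, expo (h * y n)‖ ≤ V * (h : ℝ) ^ a + W) :
    |∑ n ∈ range N, sawtooth (y n)| ≤
      N / H + (1 / a + 2) * V * (H : ℝ) ^ a + (1 / ε + 2) * W * (H : ℝ) ^ ε := by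
  have hH0 : (0 : ℝ) < H := by exact_mod_cast (by omega : 0 < H)
  have hT : ∀ M : ℕ, ∑ h ∈ Icc 1 M, 1 / (h : ℝ) ^ 2 * min 1 ((h : ℝ) / H) *
      ‖∑ n ∈ range N, expo (h * y n)‖ ≤
      V * ((1 / a + 2) * (H : ℝ) ^ (a - 1)) + W * ((1 / ε + 2) * (H : ℝ) ^ (ε - 1)) := by
    intro M
    have h1 := sum_kernel_le ha0 ha1 (by omega : 0 < H) M
    have h2 := sum_kernel_le hε0 hε1 (by omega : 0 < H) M
    refine le_trans ?_ (add_le_add (mul_le_mul_of_nonneg_left h1 hV)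
      (mul_le_mul_of_nonneg_left h2 hW))
    rw [mul_sum, mul_sum, ← sum_add_distrib]
    refine sum_le_sum fun h hh => ?_
    rw [mem_Icc] at hh
    have hh1 : (1 : ℝ) ≤ h := by exact_mod_cast hh.1
    have h3 : 1 ≤ (h : ℝ) ^ ε := Real.one_le_rpow hh1 hε0.le
    calc _ ≤ 1 / (h : ℝ) ^ 2 * min 1 ((h : ℝ) / H) * (V * (h : ℝ) ^ a + W * (h : ℝ) ^ ε) := by
          gcongr
          refine (hy h hh.1).trans ?_
          gcongr
          exact le_mul_of_one_le_right hW h3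
      _ = _ := by ring
  refine (abs_sum_sawtooth_le hH hT).trans (le_of_eq ?_)
  rw [Real.rpow_sub_one hH0.ne', Real.rpow_sub_one hH0.ne']
  field_simp
  ring

/-- The centred indicator function of `[0, b)` modulo one is a difference of sawtooths. -/
lemma indicator_fract_lt_eq {b : ℝ} (hb0 : 0 < b) (hb1 : b < 1) (t : ℝ) :
    (if Int.fract t < b then (1 : ℝ) else 0) - b = sawtooth (t - b) - sawtooth t := by
  unfold sawtooth
  have h := fract_add_cases (t - b) b hb0.le hb1
  rw [sub_add_cancel] at h
  have h0 := Int.fract_nonneg (t - b)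
  have h1 := Int.fract_lt_one (t - b)
  split_ifs with hlt
  · rcases h with h | ⟨h, h'⟩ <;> linarith
  · rcases h with h | ⟨h, h'⟩
    · linarith
    · exfalso; apply hlt; linarith

/-- Counting visits of `y n` to `[0, b)` modulo one. -/
theorem abs_card_fract_lt_sub_le {y : ℕ → ℝ} {N H : ℕ} (hH : 1 < H) {a ε V W b : ℝ}
    (ha0 : 0 < a) (ha1 : a ≤ 1 / 2) (hε0 : 0 < ε) (hε1 : ε ≤ 1 / 2) (hV : 0 ≤ V) (hW : 0 ≤ W)
    (hb0 : 0 < b) (hb1 : b < 1)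
    (hy : ∀ h : ℕ, 1 ≤ h → ‖∑ n ∈ range N, expo (h * y n)‖ ≤ V * (h : ℝ) ^ a + W) :
    |(((range N).filter fun n => Int.fract (y n) < b).card : ℝ) - N * b| ≤
      2 * (N / H + (1 / a + 2) * V * (H : ℝ) ^ a + (1 / ε + 2) * W * (H : ℝ) ^ ε) := by
  have e : (((range N).filter fun n => Int.fract (y n) < b).card : ℝ) - N * b =
      ∑ n ∈ range N, sawtooth (y n - b) - ∑ n ∈ range N, sawtooth (y n) := by
    rw [← sum_sub_distrib, ← sum_congr rfl fun n _ => indicator_fract_lt_eq hb0 hb1 (y n),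
      sum_sub_distrib]
    simp
  rw [e, two_mul]
  refine (abs_sub _ _).trans (add_le_add ?_ ?_)
  · refine abs_sum_sawtooth_le_of_bound (y := fun n => y n - b) hH ha0 ha1 hε0 hε1 hV hW ?_
    intro h hh
    refine le_trans (le_of_eq ?_) (hy h hh)
    have : ∀ n, expo (h * (y n - b)) = expo (h * y n) * expo (-(h * b)) := by
      intro n; rw [← expo_add]; congr 1; ring
    simp only [this]
    rw [← sum_mul, norm_mul, norm_expo, mul_one]
  · exact abs_sum_sawtooth_le_of_bound hH ha0 ha1 hε0 hε1 hV hW hy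

/-! ### Iterated differences of powers -/

lemma hasDerivAt_fwdDiff_iter {f f' : ℝ → ℝ} (h : ∀ y, 0 < y → HasDerivAt f (f' y) y) (k : ℕ) :
    ∀ y, 0 < y → HasDerivAt ((fwdDiff 1)^[k] f) ((fwdDiff 1)^[k] f' y) y := by
  induction k with
  | zero => simpa using h
  | succ k ih =>
    intro y hy
    rw [Function.iterate_succ_apply', Function.iterate_succ_apply']
    exact ((ih (y + 1) (by linarith)).comp_add_const y 1).sub (ih y hy)

/-- The mean value theorem for iterated differences of a power. -/
lemma exists_fwdDiff_iter_rpow_eq (k : ℕ) : ∀ s x : ℝ, 0 < x → ∃ ξ, x ≤ ξ ∧ ξ ≤ x + k ∧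
    (fwdDiff 1)^[k] (fun t : ℝ => t ^ s) x = (∏ i ∈ range k, (s - i)) * ξ ^ (s - k) := by
  induction k with
  | zero => intro s x _; exact ⟨x, by simp⟩
  | succ k ih =>
    intro s x hx
    have hder := hasDerivAt_fwdDiff_iter (f := fun t : ℝ => t ^ s)
      (f' := s • fun t : ℝ => t ^ (s - 1))
      (fun y hy => by simpa using Real.hasDerivAt_rpow_const (Or.inl hy.ne')) k
    obtain ⟨c, hc, hc'⟩ := exists_hasDerivAt_eq_slope _ _ (by linarith : x < x + 1)
      (fun y hy => (hder y (by linarith [hy.1])).continuousAt.continuousWithinAt)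
      (fun y hy => hder y (by linarith [hy.1]))
    obtain ⟨ξ, h1, h2, h3⟩ := ih (s - 1) c (by linarith [hc.1])
    refine ⟨ξ, by linarith [hc.1], by push_cast; linarith [hc.2], ?_⟩
    rw [fwdDiff_iter_const_smul, Pi.smul_apply, h3, smul_eq_mul, add_sub_cancel_left, div_one]
      at hc'
    rw [Function.iterate_succ_apply', fwdDiff, ← hc', prod_range_succ']
    push_cast
    have e : ∀ i : ℕ, s - 1 - (i : ℝ) = s - (i + 1) := fun i => by ring
    simp only [e, sub_zero]
    rw [show s - ((k : ℝ) + 1) = s - (k + 1) by ring]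
    ring

lemma fwdDiff_iter_comp_cast (f : ℝ → ℝ) (M : ℝ) (k n : ℕ) :
    (fwdDiff 1)^[k] (fun n : ℕ => f (M + n)) n = (fwdDiff 1)^[k] f (M + n) := by
  induction k generalizing n with
  | zero => rfl
  | succ k ih =>
    rw [Function.iterate_succ_apply', Function.iterate_succ_apply', fwdDiff, fwdDiff, ih, ih]
    push_cast; rw [add_assoc]

lemma rpow_mem_of_mem {R M ξ e : ℝ} (hR : 1 ≤ R) (hM : 0 < M) (h1 : M ≤ ξ) (h2 : ξ ≤ R * M) :
    R ^ (-|e|) * M ^ e ≤ ξ ^ e ∧ ξ ^ e ≤ R ^ |e| * M ^ e := by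
  have hR0 : 0 < R := by linarith
  have hξ : 0 < ξ := by linarith
  have h3 : R ^ (-|e|) ≤ 1 := Real.rpow_le_one_of_one_le_of_nonpos hR (by simp)
  have h4 : 1 ≤ R ^ |e| := Real.one_le_rpow hR (by simp)
  have hp : 0 < M ^ e := by positivity
  rcases le_total 0 e with he | he
  · have a1 := Real.rpow_le_rpow hM.le h1 he
    have a2 := Real.rpow_le_rpow hξ.le h2 he
    rw [Real.mul_rpow hR0.le hM.le] at a2
    rw [abs_of_nonneg he] at *
    exact ⟨by nlinarith, a2⟩
  · have a1 := Real.rpow_le_rpow_of_nonpos hM h1 he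
    have a2 := Real.rpow_le_rpow_of_nonpos hξ h2 he
    rw [Real.mul_rpow hR0.le hM.le] at a2
    rw [abs_of_nonpos he] at *
    rw [neg_neg] at *
    exact ⟨a2, by nlinarith⟩

lemma prod_sub_ne_zero {c : ℝ} (hc : ∀ n : ℕ, c ≠ n) (k : ℕ) : ∏ i ∈ range k, (c - i) ≠ 0 :=
  prod_ne_zero_iff.2 fun i _ => sub_ne_zero.2 (hc i)

lemma fwdDiff_iter_mul_rpow (b c M : ℝ) (hM : 0 < M) (k n : ℕ) : ∃ ξ, M + n ≤ ξ ∧ ξ ≤ M + n + k ∧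
    (fwdDiff 1)^[k] (fun n : ℕ => b * (M + n) ^ c) n =
      b * (∏ i ∈ range k, (c - i)) * ξ ^ (c - k) := by
  obtain ⟨ξ, h1, h2, h3⟩ := exists_fwdDiff_iter_rpow_eq k c (M + n) (by positivity)
  refine ⟨ξ, h1, h2, ?_⟩
  have := fwdDiff_iter_comp_cast (b • fun t : ℝ => t ^ c) M k n
  simp only [Pi.smul_apply, smul_eq_mul] at this
  rw [this, fwdDiff_iter_const_smul, Pi.smul_apply, h3, smul_eq_mul]
  ring

/-- Multiples of powers satisfy the hypothesis of the derivative test, on a block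
of at most `2 * M` integers that starts at `M`. -/
lemma diffBound_rpow {c b : ℝ} {k : ℕ} {M N : ℕ} (hM : 1 ≤ M)
    (hN : N ≤ 2 * M) (hb : 0 < b * ∏ i ∈ range k, (c - i)) :
    DiffBound k (((k : ℝ) + 3) ^ (2 * |c - k|))
      (b * (∏ i ∈ range k, (c - i)) * (((k : ℝ) + 3) ^ (-|c - k|) * (M : ℝ) ^ (c - k))) N
      (fun n => b * ((M : ℝ) + n) ^ c) := by
  have hM1 : (1 : ℝ) ≤ M := by exact_mod_cast hM
  have hM0 : (0 : ℝ) < M := by linarith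
  have hR : (1 : ℝ) ≤ k + 3 := by have : (0 : ℝ) ≤ k := by positivity
                                  linarith
  constructor
  · intro n hn
    obtain ⟨ξ, h1, h2, h3⟩ := fwdDiff_iter_mul_rpow b c M hM0 k n
    have hn' : (n : ℝ) ≤ 2 * M := by exact_mod_cast (by omega : n ≤ 2 * M)
    obtain ⟨h4, h5⟩ := rpow_mem_of_mem (e := c - k) hR hM0
      (by have : (0 : ℝ) ≤ n := by positivity
          linarith) (show ξ ≤ ((k : ℝ) + 3) * M by
        have : (k : ℝ) ≤ k * M := le_mul_of_one_le_right (by positivity) hM1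
        linarith)
    rw [h3]
    refine ⟨by gcongr, ?_⟩
    have e : ((k : ℝ) + 3) ^ (2 * |c - k|) * ((k : ℝ) + 3) ^ (-|c - k|) =
        ((k : ℝ) + 3) ^ |c - k| := by
      rw [← Real.rpow_add (by linarith)]; congr 1; ring
    calc _ ≤ b * (∏ i ∈ range k, (c - i)) * (((k : ℝ) + 3) ^ |c - k| * (M : ℝ) ^ (c - k)) := by
          gcongr
      _ = _ := by rw [← e]; ring
  · have hstep : ∀ n : ℕ, ∃ p : ℝ, 0 < p ∧
        (fwdDiff 1)^[k] (fun n : ℕ => b * ((M : ℝ) + n) ^ c) (n + 1) -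
          (fwdDiff 1)^[k] (fun n : ℕ => b * ((M : ℝ) + n) ^ c) n =
          b * (∏ i ∈ range (k + 1), (c - i)) * p := by
      intro n
      obtain ⟨ξ, h1, h2, h3⟩ := fwdDiff_iter_mul_rpow b c M hM0 (k + 1) n
      refine ⟨ξ ^ (c - (k + 1 : ℕ)), Real.rpow_pos_of_pos ?_ _, ?_⟩
      · have : (0 : ℝ) ≤ n := by positivity
        linarith
      · rw [Function.iterate_succ_apply', fwdDiff] at h3
        exact h3
    rcases le_total 0 (b * ∏ i ∈ range (k + 1), (c - i)) with h | h
    · left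
      intro n _
      obtain ⟨p, hp, hp'⟩ := hstep n
      have := mul_nonneg h hp.le
      linarith
    · right
      intro n _
      obtain ⟨p, hp, hp'⟩ := hstep n
      have := mul_nonpos_of_nonpos_of_nonneg h hp.le
      linarith

/-- The derivative test for the exponential sum of `b * m ^ c` over a block starting at `M`. -/
theorem exists_norm_sum_expo_rpow_le {c : ℝ} (hc : ∀ n : ℕ, c ≠ n) {k : ℕ} (hk : 2 ≤ k) :
    ∃ C : ℝ, 0 ≤ C ∧ ∀ M : ℕ, 1 ≤ M → ∀ N : ℕ, N ≤ 2 * M → ∀ b : ℝ, 0 < b →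
      ‖∑ n ∈ range N, expo (b * ((M : ℝ) + n) ^ c)‖ ≤
        C * (M * ((b * (M : ℝ) ^ (c - k)) ^ (1 / ((2 : ℝ) ^ k - 2)) + (1 + Real.log (2 * M)) *
        ((M : ℝ) ^ (-(2 / (2 : ℝ) ^ k)) + (b * (M : ℝ) ^ c) ^ (-(2 / (2 : ℝ) ^ k))))) := by
  have hR : (1 : ℝ) ≤ k + 3 := by have : (0 : ℝ) ≤ k := by positivity
                                  linarith
  obtain ⟨C, hC, hmain⟩ := exists_norm_sum_expo_le
    (A := ((k : ℝ) + 3) ^ (2 * |c - k|)) (Real.one_le_rpow hR (by positivity)) hk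
  set κ := |∏ i ∈ range k, (c - i)| with hκ
  have hκ0 : 0 < κ := abs_pos.2 (prod_sub_ne_zero hc k)
  set g := κ * ((k : ℝ) + 3) ^ (-|c - k|) with hg
  have hg0 : 0 < g := by positivity
  set α := 1 / ((2 : ℝ) ^ k - 2) with hα
  set β := 2 / (2 : ℝ) ^ k with hβ
  have hβ0 : 0 < β := by positivity
  have hkβ : k * β ≤ 1 := by
    have := two_mul_le_two_pow (by omega : 1 ≤ k)
    rw [hβ, mul_div_assoc', div_le_iff₀ (by positivity)]; linarith
  have hβ1 : β ≤ 1 := by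
    have : (2 : ℝ) ≤ k := by exact_mod_cast hk
    nlinarith
  refine ⟨C * (2 * (g ^ α + 1 + g ^ (-β))), by positivity, fun M hM N hN b hb => ?_⟩
  have hM1 : (1 : ℝ) ≤ M := by exact_mod_cast hM
  have hM0 : (0 : ℝ) < M := by linarith
  have hlog : 0 ≤ Real.log (2 * M) := Real.log_nonneg (by linarith)
  rcases Nat.eq_zero_or_pos N with rfl | hN0
  · simp only [range_zero, sum_empty, norm_zero]; positivity
  set lam := b * g * (M : ℝ) ^ (c - k) with hlam
  have hlam0 : 0 < lam := by positivity
  have hsum : ‖∑ n ∈ range N, expo (b * ((M : ℝ) + n) ^ c)‖ ≤ C * (N * (lam ^ α +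
      (1 + Real.log N) * ((N : ℝ) ^ (-β) + ((N : ℝ) ^ k * lam) ^ (-β)))) := by
    rcases lt_or_gt_of_ne (prod_sub_ne_zero hc k) with hneg | hpos
    · have hd := diffBound_rpow (b := -b) (c := c) (k := k) hM hN (by nlinarith)
      have e : -b * (∏ i ∈ range k, (c - i)) * (((k : ℝ) + 3) ^ (-|c - k|) * (M : ℝ) ^ (c - k)) =
          lam := by rw [hlam, hg, hκ, abs_of_neg hneg]; ring
      rw [e] at hd
      have := hmain N hN0 lam hlam0 _ hd
      simp only [neg_mul] at this
      rwa [norm_sum_expo_neg (fun n => b * ((M : ℝ) + n) ^ c)] at this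
    · have hd := diffBound_rpow (b := b) (c := c) (k := k) hM hN (by positivity)
      have e : b * (∏ i ∈ range k, (c - i)) * (((k : ℝ) + 3) ^ (-|c - k|) * (M : ℝ) ^ (c - k)) =
          lam := by rw [hlam, hg, hκ, abs_of_pos hpos]; ring
      rw [e] at hd
      exact hmain N hN0 lam hlam0 _ hd
  refine hsum.trans ?_
  rw [mul_assoc C]
  gcongr ?_ * ?_
  refine (vdc_bound_mono (α := α) hβ1 hkβ hlam0 (by exact_mod_cast hN0)
    (by exact_mod_cast hN : (N : ℝ) ≤ 2 * M)).trans ?_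
  have e1 : lam ^ α = g ^ α * (b * (M : ℝ) ^ (c - k)) ^ α := by
    rw [← Real.mul_rpow hg0.le (by positivity)]; congr 1; rw [hlam]; ring
  have e2 : (2 * (M : ℝ)) ^ (-β) ≤ (M : ℝ) ^ (-β) :=
    Real.rpow_le_rpow_of_nonpos hM0 (by linarith) (by linarith)
  have e3 : ((2 * (M : ℝ)) ^ k * lam) ^ (-β) ≤ g ^ (-β) * (b * (M : ℝ) ^ c) ^ (-β) := by
    rw [← Real.mul_rpow hg0.le (by positivity)]
    apply Real.rpow_le_rpow_of_nonpos (by positivity) _ (by linarith)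
    have : (M : ℝ) ^ c = (M : ℝ) ^ k * (M : ℝ) ^ (c - k) := by
      rw [← Real.rpow_natCast, ← Real.rpow_add hM0]; congr 1; ring
    rw [this]
    calc _ = 1 * (M : ℝ) ^ k * lam := by rw [hlam]; ring
      _ ≤ 2 ^ k * (M : ℝ) ^ k * lam := by gcongr; exact one_le_pow₀ (by norm_num)
      _ = _ := by ring
  set a1 := (b * (M : ℝ) ^ (c - k)) ^ α
  set a2 := (M : ℝ) ^ (-β)
  set a3 := (b * (M : ℝ) ^ c) ^ (-β)
  set L := 1 + Real.log (2 * M)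
  have hL : 0 ≤ L := by positivity
  have p1 : 0 ≤ a1 := by positivity
  have p2 : 0 ≤ L * a2 := by positivity
  have p3 : 0 ≤ L * a3 := by positivity
  have p4 : 0 ≤ g ^ α := by positivity
  have p5 : 0 ≤ g ^ (-β) := by positivity
  calc _ ≤ 2 * M * (g ^ α * a1 + L * (a2 + g ^ (-β) * a3)) := by rw [e1]; gcongr
    _ ≤ 2 * M * ((g ^ α + 1 + g ^ (-β)) * (a1 + L * (a2 + a3))) := by
      gcongr
      have := mul_nonneg p4 p2
      have := mul_nonneg p4 p3
      have := mul_nonneg p5 p1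
      have := mul_nonneg p5 p2
      nlinarith
    _ = _ := by ring

/-! ### The distribution of `[m ^ c]` modulo `d` over a block -/

lemma dvd_floor_iff_fract_lt {y : ℝ} (hy : 0 ≤ y) {d : ℕ} (hd : 0 < d) :
    d ∣ ⌊y⌋₊ ↔ Int.fract (y / d) < 1 / d := by
  have hd0 : (0 : ℝ) < d := by exact_mod_cast hd
  have hfl : (⌊y / d⌋ : ℝ) = ((⌊y⌋₊ / d : ℕ) : ℝ) := by
    rw [← Nat.floor_div_natCast, natCast_floor_eq_intCast_floor (by positivity)]
  have h1 := Nat.floor_le hy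
  have h2 := Nat.lt_floor_add_one y
  have hdm : ((d * (⌊y⌋₊ / d) + ⌊y⌋₊ % d : ℕ) : ℝ) = ⌊y⌋₊ := by rw [Nat.div_add_mod]
  push_cast at hdm
  rw [Int.fract, hfl, lt_div_iff₀ hd0, sub_mul, div_mul_cancel₀ _ hd0.ne', Nat.dvd_iff_mod_eq_zero]
  constructor
  · intro h
    rw [h] at hdm
    push_cast at hdm
    linarith
  · intro h
    by_contra hne
    have : (1 : ℝ) ≤ ((⌊y⌋₊ % d : ℕ) : ℝ) := by exact_mod_cast Nat.one_le_iff_ne_zero.2 hne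
    linarith

/-- The number of `m ≤ X` for which `d` divides `[m ^ c]`. -/
noncomputable def psCount (c : ℝ) (d X : ℕ) : ℕ := ((Icc 1 X).filter fun m => d ∣ psTerm c m).card

/-- The number of `m` in `[M, M + N)` for which `d` divides `[m ^ c]`. -/
noncomputable def psBlockCount (c : ℝ) (d M N : ℕ) : ℕ :=
  ((range N).filter fun n => d ∣ psTerm c (M + n)).card

lemma psCount_add (c : ℝ) (d Y N : ℕ) :
    psCount c d (Y + N) = psCount c d Y + psBlockCount c d (Y + 1) N := by
  unfold psCount psBlockCount
  simp only [card_filter]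
  induction N with
  | zero => simp
  | succ N ih =>
    rw [← add_assoc, sum_Icc_succ_top (by omega), ih, sum_range_succ, add_assoc,
      show Y + N + 1 = Y + 1 + N by ring]

lemma psTerm_lt_succ {c : ℝ} (hc : 1 ≤ c) (m : ℕ) : psTerm c m < psTerm c (m + 1) := by
  unfold psTerm
  rw [← Nat.succ_le_iff, Nat.succ_eq_add_one, ← Nat.floor_add_one (by positivity)]
  apply Nat.floor_le_floor
  have := Real.add_rpow_le_rpow_add (a := (m : ℝ)) (b := 1) (by positivity) (by norm_num) hc
  rw [Real.one_rpow] at this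
  push_cast
  exact this

lemma psTerm_strictMono {c : ℝ} (hc : 1 ≤ c) : StrictMono (psTerm c) :=
  strictMono_nat_of_lt_succ (psTerm_lt_succ hc)

lemma psTerm_pos {c : ℝ} (hc : 1 ≤ c) {m : ℕ} (hm : 1 ≤ m) : 0 < psTerm c m :=
  lt_of_le_of_lt (Nat.zero_le _) (psTerm_strictMono hc (by omega : 0 < m))

lemma psTerm_le (c : ℝ) (m : ℕ) : (psTerm c m : ℝ) ≤ (m : ℝ) ^ c := Nat.floor_le (by positivity)

/-- For `c ≥ 1` the values `[m ^ c]` are distinct, so at most `X ^ c / d` of them are multiples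
of `d`. -/
lemma psCount_le_div {c : ℝ} (hc : 1 ≤ c) (d X : ℕ) :
    (psCount c d X : ℝ) ≤ (X : ℝ) ^ c / d := by
  have h1 : psCount c d X ≤ psTerm c X / d := by
    rw [← Nat.Ioc_filter_dvd_card_eq_div]
    refine card_le_card_of_injOn (psTerm c) ?_ ((psTerm_strictMono hc).injective.injOn)
    intro m hm
    simp only [coe_filter, mem_Icc, mem_Ioc, Set.mem_ofPred_eq] at hm ⊢
    exact ⟨⟨psTerm_pos hc hm.1.1, (psTerm_strictMono hc).monotone hm.1.2⟩, hm.2⟩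
  calc (psCount c d X : ℝ) ≤ ((psTerm c X / d : ℕ) : ℝ) := by exact_mod_cast h1
    _ ≤ (psTerm c X : ℝ) / d := Nat.cast_div_le
    _ ≤ _ := by gcongr; exact psTerm_le c X

lemma psCount_le (c : ℝ) (d X : ℕ) : psCount c d X ≤ X := by
  refine (card_filter_le _ _).trans ?_
  simp

lemma psBlockCount_le (c : ℝ) (hc : 1 ≤ c) (d : ℕ) {M N : ℕ} (hM : 1 ≤ M) (hN : N ≤ M) :
    (psBlockCount c d M N : ℝ) ≤ (2 * M : ℝ) ^ c / d := by
  have h := psCount_add c d (M - 1) N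
  rw [Nat.sub_add_cancel hM] at h
  have h1 := psCount_le_div hc d (M - 1 + N)
  have h2 : ((M - 1 + N : ℕ) : ℝ) ≤ 2 * M := by exact_mod_cast (by omega : M - 1 + N ≤ 2 * M)
  calc (psBlockCount c d M N : ℝ) ≤ psCount c d (M - 1 + N) := by exact_mod_cast (by omega)
    _ ≤ _ := h1
    _ ≤ _ := by gcongr

set_option maxHeartbeats 800000 in
/-- The derivative test of order `k` for the distribution of `[m ^ c]` modulo `d` over a block. -/
theorem exists_abs_psBlockCount_sub_le {c : ℝ} (hc : ∀ n : ℕ, c ≠ n) {k : ℕ}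
    (hk : 2 ≤ k) {ε : ℝ} (hε0 : 0 < ε) (hε1 : ε ≤ 1) :
    ∃ C : ℝ, 0 ≤ C ∧ ∀ M : ℕ, 1 ≤ M → ∀ N : ℕ, N ≤ M → ∀ d : ℕ, 2 ≤ d →
      (M : ℝ) ^ (c - k) ≤ d → (d : ℝ) ≤ (M : ℝ) ^ c →
      |(psBlockCount c d M N : ℝ) - N / d| ≤
        C * (M * ((M : ℝ) ^ (c - k) / d) ^ (1 / ((2 : ℝ) ^ k - 1)) + (M : ℝ) ^ (1 + ε) *
          ((M : ℝ) ^ (-(2 / (2 : ℝ) ^ k)) + ((M : ℝ) ^ c / d) ^ (-(2 / (2 : ℝ) ^ k)))) := by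
  obtain ⟨C, hC, hmain⟩ := exists_norm_sum_expo_rpow_le hc hk
  have h4 := four_le_two_pow hk
  set α := 1 / ((2 : ℝ) ^ k - 2) with hα
  set β := 2 / (2 : ℝ) ^ k with hβ
  set η := 1 / ((2 : ℝ) ^ k - 1) with hη
  have hα0 : 0 < α := one_div_pos.2 (by linarith)
  have hα1 : α ≤ 1 / 2 := one_div_le_one_div_of_le (by norm_num) (by linarith)
  have hη0 : 0 < η := one_div_pos.2 (by linarith)
  have hη1 : η ≤ 1 := by
    rw [hη, div_le_one (by linarith)]; linarith
  have hβ0 : 0 < β := by positivity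
  have hαη : α + -η * α = η := by
    have h5 : (2 : ℝ) ^ k - 2 ≠ 0 := by linarith
    have h6 : (2 : ℝ) ^ k - 1 ≠ 0 := by linarith
    rw [hα, hη]; field_simp; ring
  set ε' := ε / (k + 1) with hε'
  have hk0 : (2 : ℝ) ≤ k := by exact_mod_cast hk
  have hε'0 : 0 < ε' := by positivity
  have hε'1 : ε' ≤ 1 / 2 := by
    rw [hε', div_le_div_iff₀ (by linarith) (by norm_num)]; linarith
  refine ⟨2 * (2 + (1 / α + 2) * C * 3 + (1 / ε' + 2) * C * 3 * (2 + 1 / ε')), by positivity,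
    fun M hM N hN d hd hdl hdu => ?_⟩
  have hM1 : (1 : ℝ) ≤ M := by exact_mod_cast hM
  have hM0 : (0 : ℝ) < M := by linarith
  have hd1 : (2 : ℝ) ≤ d := by exact_mod_cast hd
  have hd0 : (0 : ℝ) < d := by linarith
  set lam := (M : ℝ) ^ (c - k) / d with hlam
  have hlam0 : 0 < lam := by positivity
  have hlam1 : lam ≤ 1 := (div_le_one hd0).2 hdl
  set G := (M : ℝ) ^ (-β) + ((M : ℝ) ^ c / d) ^ (-β) with hG
  have hG0 : 0 ≤ G := by positivity
  set L := 1 + Real.log (2 * M) with hL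
  have hL0 : 0 ≤ L := by have := Real.log_nonneg (by linarith : (1 : ℝ) ≤ 2 * M); linarith
  have hLle : L ≤ (2 + 1 / ε') * (M : ℝ) ^ ε' := by
    rw [hL, Real.log_mul (by norm_num) hM0.ne']
    have h1 := Real.log_le_rpow_div hM0.le hε'0
    have h2 : Real.log 2 ≤ 1 := by linarith [Real.log_two_lt_d9]
    have h3 : 1 ≤ (M : ℝ) ^ ε' := Real.one_le_rpow hM1 hε'0.le
    rw [add_mul, one_div_mul_eq_div]
    linarith
  have hlp : 1 ≤ lam ^ (-η) :=
    Real.one_le_rpow_of_pos_of_le_one_of_nonpos hlam0 hlam1 (by linarith)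
  -- The truncation `H` equates `M / H` with the main term of the exponential sums.
  set H := max 2 ⌈lam ^ (-η)⌉₊ with hH
  have hH2 : 2 ≤ H := le_max_left _ _
  have hH0 : (0 : ℝ) < H := by exact_mod_cast (by omega : 0 < H)
  have hHl : lam ^ (-η) ≤ H := (Nat.le_ceil _).trans (by exact_mod_cast le_max_right _ _)
  have hHu : (H : ℝ) ≤ 3 * lam ^ (-η) := by
    rw [hH, Nat.cast_max]
    apply max_le
    · push_cast; linarith
    · have := (Nat.ceil_lt_add_one (by positivity : 0 ≤ lam ^ (-η))).le
      linarith
  have three : ∀ t : ℝ, 0 ≤ t → t ≤ 1 → (3 : ℝ) ^ t ≤ 3 := by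
    intro t _ h1
    simpa using Real.rpow_le_rpow_of_exponent_le (x := 3) (by norm_num) h1
  have hHpow : ∀ t : ℝ, 0 ≤ t → t ≤ 1 → (H : ℝ) ^ t ≤ 3 * lam ^ (-η * t) := by
    intro t h0 h1
    have := Real.rpow_le_rpow hH0.le hHu h0
    rw [Real.mul_rpow (by norm_num) (by positivity), ← Real.rpow_mul hlam0.le] at this
    exact this.trans (by gcongr; exact three t h0 h1)
  have hcount : (psBlockCount c d M N : ℝ) =
      ((range N).filter fun n : ℕ => Int.fract (((M : ℝ) + n) ^ c / d) < 1 / d).card := by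
    unfold psBlockCount psTerm
    congr 2
    ext n
    simp only [mem_filter]
    rw [dvd_floor_iff_fract_lt (by positivity) (by omega), Nat.cast_add]
  have hexp : ∀ h : ℕ, 1 ≤ h → ‖∑ n ∈ range N, expo (h * (((M : ℝ) + n) ^ c / d))‖ ≤
      C * M * lam ^ α * (h : ℝ) ^ α + C * M * L * G := by
    intro h hh
    have hh1 : (1 : ℝ) ≤ h := by exact_mod_cast hh
    have := hmain M hM N (by omega) (h / d) (by positivity)
    have e : ∀ n : ℕ, (h : ℝ) * (((M : ℝ) + n) ^ c / d) = h / d * ((M : ℝ) + n) ^ c := by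
      intro n; ring
    simp only [e]
    refine this.trans ?_
    have e1 : (h / d * (M : ℝ) ^ (c - k)) ^ α = lam ^ α * (h : ℝ) ^ α := by
      rw [← Real.mul_rpow hlam0.le (by positivity)]; congr 1; rw [hlam]; ring
    have e2 : (h / d * (M : ℝ) ^ c) ^ (-β) ≤ ((M : ℝ) ^ c / d) ^ (-β) := by
      apply Real.rpow_le_rpow_of_nonpos (by positivity) _ (by linarith)
      calc (M : ℝ) ^ c / d = 1 * ((M : ℝ) ^ c / d) := by ring
        _ ≤ h * ((M : ℝ) ^ c / d) := by gcongr
        _ = _ := by ring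
    rw [e1]
    calc _ ≤ C * (M * (lam ^ α * (h : ℝ) ^ α + L * G)) := by
          gcongr; exact add_le_add le_rfl e2
      _ = _ := by ring
  have hfin := abs_card_fract_lt_sub_le (y := fun n => ((M : ℝ) + n) ^ c / d) (N := N) (H := H)
    (b := 1 / d) (by omega) hα0 hα1 hε'0 hε'1 (by positivity) (by positivity) (by positivity)
    (by rw [div_lt_one hd0]; linarith) hexp
  rw [hcount]
  rw [mul_one_div] at hfin
  refine hfin.trans ?_
  rw [mul_assoc 2]
  gcongr 2 * ?_
  have t1 : (N : ℝ) / H ≤ 2 * (M * lam ^ η) := by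
    have hNM : (N : ℝ) ≤ M := by exact_mod_cast hN
    have : (1 : ℝ) / H ≤ lam ^ η := by
      rw [div_le_iff₀ hH0]
      rw [Real.rpow_neg hlam0.le, inv_le_iff_one_le_mul₀' (by positivity)] at hHl
      exact hHl
    calc (N : ℝ) / H = N * (1 / H) := by ring
      _ ≤ M * lam ^ η := by gcongr
      _ ≤ _ := by have : 0 ≤ M * lam ^ η := by positivity
                  linarith
  have t2 : (1 / α + 2) * (C * M * lam ^ α) * (H : ℝ) ^ α ≤
      (1 / α + 2) * C * 3 * (M * lam ^ η) := by
    have := hHpow α hα0.le (by linarith)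
    calc _ ≤ (1 / α + 2) * (C * M * lam ^ α) * (3 * lam ^ (-η * α)) := by gcongr
      _ = (1 / α + 2) * C * 3 * (M * (lam ^ α * lam ^ (-η * α))) := by ring
      _ = _ := by rw [← Real.rpow_add hlam0, hαη]
  have t3 : (1 / ε' + 2) * (C * M * L * G) * (H : ℝ) ^ ε' ≤
      (1 / ε' + 2) * C * 3 * (2 + 1 / ε') * ((M : ℝ) ^ (1 + ε) * G) := by
    have h1 := hHpow ε' hε'0.le (by linarith)
    have h2 : lam ^ (-η * ε') ≤ (M : ℝ) ^ (k * ε') := by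
      have h3 : (M : ℝ) ^ (-(k : ℝ)) ≤ lam := by
        rw [hlam, le_div_iff₀ hd0]
        calc _ ≤ (M : ℝ) ^ (-(k : ℝ)) * (M : ℝ) ^ c := by gcongr
          _ = _ := by rw [← Real.rpow_add hM0]; congr 1; ring
      have h5 := Real.rpow_le_rpow_of_nonpos (by positivity) h3 (by nlinarith : -η * ε' ≤ 0)
      rw [← Real.rpow_mul hM0.le] at h5
      refine h5.trans (Real.rpow_le_rpow_of_exponent_le hM1 ?_)
      have : 0 < (k : ℝ) * ε' := by positivity
      nlinarith
    have e : (M : ℝ) ^ (1 + ε) = M * ((M : ℝ) ^ ε' * (M : ℝ) ^ (k * ε')) := by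
      rw [← Real.rpow_add hM0, Real.rpow_add hM0, Real.rpow_one]
      congr 2; rw [hε']; field_simp; ring
    calc _ ≤ (1 / ε' + 2) * (C * M * ((2 + 1 / ε') * (M : ℝ) ^ ε') * G) *
          (3 * (M : ℝ) ^ (k * ε')) := by
          gcongr
          exact h1.trans (by gcongr)
      _ = _ := by rw [e]; ring
  set P := M * lam ^ η
  set R := (M : ℝ) ^ (1 + ε) * G
  have hP : 0 ≤ P := by positivity
  have hR : 0 ≤ R := by positivity
  have q1 : 0 ≤ 2 * R := by positivity
  have q2 : 0 ≤ (1 / α + 2) * C * 3 * R := by positivity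
  have q3 : 0 ≤ (1 / ε' + 2) * C * 3 * (2 + 1 / ε') * P := by positivity
  calc _ ≤ 2 * P + (1 / α + 2) * C * 3 * P +
        (1 / ε' + 2) * C * 3 * (2 + 1 / ε') * R := add_le_add (add_le_add t1 t2) t3
    _ ≤ _ := by linarith

/-! ### Uniformity in the modulus -/

/-- For moduli `d ≥ M ^ (c - 1)` the second-derivative test and the trivial bound, according to
the size of `d`, give the exponent `2/3`. -/
lemma exists_abs_psBlockCount_sub_le_of_large {c : ℝ} (hc1 : 1 < c) (hc : ∀ n : ℕ, c ≠ n)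
    {ε : ℝ} (hε0 : 0 < ε) (hε1 : ε ≤ 1) :
    ∃ K : ℝ, 0 ≤ K ∧ ∀ M : ℕ, 1 ≤ M → ∀ N : ℕ, N ≤ M → ∀ d : ℕ, 2 ≤ d →
      (M : ℝ) ^ (c - 1) ≤ d → |(psBlockCount c d M N : ℝ) - N / d| ≤ K * (M : ℝ) ^ (2 / 3 + ε) := by
  obtain ⟨C, hC, h2⟩ := exists_abs_psBlockCount_sub_le hc le_rfl hε0 hε1
  refine ⟨3 * C + (2 ^ c + 1), by positivity, fun M hM N hN d hd hdl => ?_⟩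
  have hM1 : (1 : ℝ) ≤ M := by exact_mod_cast hM
  have hM0 : (0 : ℝ) < M := by linarith
  have hd0 : (0 : ℝ) < d := by exact_mod_cast (by omega : 0 < d)
  have hmono : ∀ {a b : ℝ}, a ≤ b → (M : ℝ) ^ a ≤ (M : ℝ) ^ b := fun h =>
    Real.rpow_le_rpow_of_exponent_le hM1 h
  rw [add_mul]
  rcases le_or_gt (d : ℝ) ((M : ℝ) ^ (c - 2 / 3)) with hsm | hlg
  · have h := h2 M hM N hN d hd ((hmono (by push_cast; linarith)).trans hdl)
      (hsm.trans (hmono (by linarith)))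
    refine h.trans (le_trans ?_ (le_add_of_nonneg_right (by positivity)))
    have a1 : (M : ℝ) * ((M : ℝ) ^ (c - (2 : ℕ)) / d) ^ (1 / ((2 : ℝ) ^ 2 - 1)) ≤
        (M : ℝ) ^ (2 / 3 + ε) := by
      have : (M : ℝ) ^ (c - (2 : ℕ)) / d ≤ (M : ℝ) ^ (-1 : ℝ) := by
        rw [div_le_iff₀ hd0]
        calc _ = (M : ℝ) ^ (-1 : ℝ) * (M : ℝ) ^ (c - 1) := by
              rw [← Real.rpow_add hM0]; congr 1; push_cast; ring
          _ ≤ _ := by gcongr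
      have h3 := Real.rpow_le_rpow (by positivity) this
        (by norm_num : (0 : ℝ) ≤ 1 / ((2 : ℝ) ^ 2 - 1))
      rw [← Real.rpow_mul hM0.le] at h3
      calc _ ≤ (M : ℝ) ^ (1 : ℝ) * (M : ℝ) ^ (-1 * (1 / ((2 : ℝ) ^ 2 - 1))) := by
            rw [Real.rpow_one]; gcongr
        _ = (M : ℝ) ^ (1 + -1 * (1 / ((2 : ℝ) ^ 2 - 1))) := by rw [← Real.rpow_add hM0]
        _ ≤ _ := hmono (by norm_num; linarith)
    have a2 : (M : ℝ) ^ (-(2 / (2 : ℝ) ^ 2)) ≤ (M : ℝ) ^ (-(1 / 3) : ℝ) := hmono (by norm_num)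
    have a3 : ((M : ℝ) ^ c / d) ^ (-(2 / (2 : ℝ) ^ 2)) ≤ (M : ℝ) ^ (-(1 / 3) : ℝ) := by
      have : (M : ℝ) ^ (2 / 3 : ℝ) ≤ (M : ℝ) ^ c / d := by
        rw [le_div_iff₀ hd0]
        calc _ ≤ (M : ℝ) ^ (2 / 3 : ℝ) * (M : ℝ) ^ (c - 2 / 3) := by gcongr
          _ = _ := by rw [← Real.rpow_add hM0]; congr 1; ring
      have h3 := Real.rpow_le_rpow_of_nonpos (by positivity) this
        (by norm_num : -(2 / (2 : ℝ) ^ 2) ≤ 0)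
      rw [← Real.rpow_mul hM0.le] at h3
      exact h3.trans (hmono (by norm_num))
    have a4 : (M : ℝ) ^ (1 + ε) * (M : ℝ) ^ (-(1 / 3) : ℝ) = (M : ℝ) ^ (2 / 3 + ε) := by
      rw [← Real.rpow_add hM0]; congr 1; ring
    calc _ ≤ C * ((M : ℝ) ^ (2 / 3 + ε) + (M : ℝ) ^ (1 + ε) *
          ((M : ℝ) ^ (-(1 / 3) : ℝ) + (M : ℝ) ^ (-(1 / 3) : ℝ))) := by gcongr
      _ = _ := by rw [mul_add ((M : ℝ) ^ (1 + ε)), a4]; ring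
  · refine le_trans ?_ (le_add_of_nonneg_left (by positivity))
    have hb := psBlockCount_le c hc1.le d hM hN
    have b1 : (2 * M : ℝ) ^ c / d ≤ 2 ^ c * (M : ℝ) ^ (2 / 3 + ε) := by
      rw [Real.mul_rpow (by norm_num) hM0.le, mul_div_assoc]
      gcongr
      rw [div_le_iff₀ hd0]
      calc (M : ℝ) ^ c = (M : ℝ) ^ (2 / 3 : ℝ) * (M : ℝ) ^ (c - 2 / 3) := by
            rw [← Real.rpow_add hM0]; congr 1; ring
        _ ≤ _ := by
            gcongr
            linarith
    have b2 : (N : ℝ) / d ≤ (M : ℝ) ^ (2 / 3 + ε) := by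
      rw [div_le_iff₀ hd0]
      have hNM : (N : ℝ) ≤ M := by exact_mod_cast hN
      calc (N : ℝ) ≤ (M : ℝ) ^ (1 : ℝ) := by rw [Real.rpow_one]; exact hNM
        _ ≤ (M : ℝ) ^ ((2 / 3 + ε) + (c - 2 / 3)) := hmono (by linarith)
        _ = (M : ℝ) ^ (2 / 3 + ε) * (M : ℝ) ^ (c - 2 / 3) := Real.rpow_add hM0 _ _
        _ ≤ _ := by gcongr
    have b3 : (0 : ℝ) ≤ psBlockCount c d M N := by positivity
    have b4 : (0 : ℝ) ≤ N / d := by positivity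
    rw [abs_le]
    constructor <;> nlinarith [Real.rpow_nonneg hM0.le (2 / 3 + ε),
      Real.rpow_nonneg (by norm_num : (0 : ℝ) ≤ 2) c]

/-- The saving `(k - c) / (2 ^ k - 1)` is at most `1/3` for `c ≥ 1`. -/
lemma saving_le_third {k : ℕ} (hk : 2 ≤ k) : (k - 1) / ((2 : ℝ) ^ k - 1) ≤ 1 / 3 := by
  have h4 := four_le_two_pow hk
  rw [div_le_div_iff₀ (by linarith) (by norm_num)]
  have : ∀ m : ℕ, 2 ≤ m → 3 * m ≤ 2 ^ m + 2 := by
    intro m hm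
    induction m, hm using Nat.le_induction with
    | base => norm_num
    | succ m hm ih =>
      have : 4 ≤ 2 ^ m := le_trans (by norm_num) (Nat.pow_le_pow_right (by norm_num) hm)
      rw [pow_succ]; omega
  have : 3 * (k : ℝ) ≤ 2 ^ k + 2 := by exact_mod_cast this k hk
  linarith

/-- Since `d` is at most a power of `M`, a factor `d ^ (-ε)` is paid for by a power of `M`. -/
lemma rpow_le_mul_rpow_of_modulus {c ε δ θ M d : ℝ} (hε : 0 ≤ ε) (hM : 1 ≤ M) (hd0 : 0 < d)
    (hd : d ≤ (2 * M) ^ c) (h : θ + c * ε ≤ 1 - δ) :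
    M ^ θ ≤ 2 ^ (c * ε) * (M ^ (1 - δ) * d ^ (-ε)) := by
  have hM0 : 0 < M := by linarith
  have h1 := Real.rpow_le_rpow_of_nonpos hd0 hd (by linarith : -ε ≤ 0)
  rw [← Real.rpow_mul (by positivity), Real.mul_rpow (by norm_num) hM0.le] at h1
  calc M ^ θ ≤ M ^ ((1 - δ) + c * -ε) := Real.rpow_le_rpow_of_exponent_le hM (by linarith)
    _ = (2 ^ (c * ε) * 2 ^ (c * -ε)) * (M ^ (1 - δ) * M ^ (c * -ε)) := by
      rw [← Real.rpow_add hM0, ← Real.rpow_add (by norm_num)]; ring_nf; simp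
    _ = 2 ^ (c * ε) * (M ^ (1 - δ) * (2 ^ (c * -ε) * M ^ (c * -ε))) := by ring
    _ ≤ _ := by gcongr

/-- The distribution of `[m ^ c]` modulo `d` over a block, with a saving `d ^ (-ε)` in the error
term. The derivative test of order `k` yields this directly when `k - c < 2 - 2 / 2 ^ k`;
otherwise order `k - 1` already saves at least as much. -/
theorem exists_abs_psBlockCount_sub_le_rpow {c : ℝ} (hc1 : 1 < c) (hc : ∀ n : ℕ, c ≠ n) {k : ℕ}
    (hk : 2 ≤ k) : c < k →
    ∃ ε : ℝ, 0 < ε ∧ c * ε ≤ 1 / 2 ∧ ∃ K : ℝ, 0 ≤ K ∧ ∀ M : ℕ, 1 ≤ M → ∀ N : ℕ, N ≤ M →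
      ∀ d : ℕ, 2 ≤ d → (d : ℝ) ≤ (2 * M : ℝ) ^ c →
      |(psBlockCount c d M N : ℝ) - N / d| ≤
        K * ((M : ℝ) ^ (1 - (k - c) / ((2 : ℝ) ^ k - 1)) * (d : ℝ) ^ (-ε)) := by
  have hdirect : ∀ k : ℕ, 2 ≤ k → c < k → (k : ℝ) - c < 2 - 2 / (2 : ℝ) ^ k →
    ∃ ε : ℝ, 0 < ε ∧ c * ε ≤ 1 / 2 ∧ ∃ K : ℝ, 0 ≤ K ∧ ∀ M : ℕ, 1 ≤ M → ∀ N : ℕ, N ≤ M →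
      ∀ d : ℕ, 2 ≤ d → (d : ℝ) ≤ (2 * M : ℝ) ^ c →
      |(psBlockCount c d M N : ℝ) - N / d| ≤
        K * ((M : ℝ) ^ (1 - (k - c) / ((2 : ℝ) ^ k - 1)) * (d : ℝ) ^ (-ε)) := by
    intro k hk hck hgap
    have h4 := four_le_two_pow hk
    set β := 2 / (2 : ℝ) ^ k with hβ
    set η := 1 / ((2 : ℝ) ^ k - 1) with hη
    set δ := ((k : ℝ) - c) / ((2 : ℝ) ^ k - 1) with hδ
    have hη0 : 0 < η := one_div_pos.2 (by linarith)
    have hβ0 : 0 < β := by positivity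
    have hδ3 : δ < 1 / 3 := by
      refine lt_of_lt_of_le ?_ (saving_le_third hk)
      rw [hδ]
      gcongr
      linarith
    have hδβ : δ < β := by
      rw [hδ, div_lt_iff₀ (by linarith)]
      have : β * ((2 : ℝ) ^ k - 1) = 2 - β := by rw [hβ]; field_simp
      rw [this]; exact hgap
    have hδ0 : 0 < δ := div_pos (by linarith) (by linarith)
    -- The room `g` between the target exponent and those of the secondary terms pays for the
    -- factor `d ^ (-ε)` and for the logarithms.
    set g := min (1 / 3 - δ) (β - δ) with hg
    have hg0 : 0 < g := lt_min (by linarith) (by linarith)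
    have hg1 : g ≤ 1 / 3 - δ := min_le_left _ _
    have hg2 : g ≤ β - δ := min_le_right _ _
    set ε := min η (g / (2 * c)) with hε
    have hε0 : 0 < ε := lt_min hη0 (by positivity)
    have hεη : ε ≤ η := min_le_left _ _
    have hcε : c * ε ≤ g / 2 := by
      have : ε ≤ g / (2 * c) := min_le_right _ _
      calc c * ε ≤ c * (g / (2 * c)) := by gcongr
        _ = g / 2 := by field_simp
    obtain ⟨K1, hK1, hlarge⟩ := exists_abs_psBlockCount_sub_le_of_large hc1 hc
      (ε := g / 2) (by linarith) (by linarith)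
    obtain ⟨C, hC, htest⟩ := exists_abs_psBlockCount_sub_le hc hk
      (ε := g / 2) (by linarith) (by linarith)
    refine ⟨ε, hε0, by linarith, K1 * 2 ^ (c * ε) + C * (1 + 2 * 2 ^ (c * ε)), by positivity,
      fun M hM N hN d hd hdM => ?_⟩
    have hM1 : (1 : ℝ) ≤ M := by exact_mod_cast hM
    have hM0 : (0 : ℝ) < M := by linarith
    have hd1 : (1 : ℝ) ≤ d := by exact_mod_cast (by omega : 1 ≤ d)
    have hd0 : (0 : ℝ) < d := by linarith
    set Y := (M : ℝ) ^ (1 - δ) * (d : ℝ) ^ (-ε) with hY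
    have hY0 : 0 < Y := by positivity
    rw [add_mul]
    rcases le_or_gt ((M : ℝ) ^ (c - 1)) d with hl | hs
    · refine (hlarge M hM N hN d hd hl).trans (le_trans ?_ (le_add_of_nonneg_right
        (by positivity)))
      rw [mul_assoc]
      gcongr
      exact rpow_le_mul_rpow_of_modulus hε0.le hM1 hd0 hdM (by linarith)
    · have hck0 : (M : ℝ) ^ (c - k) ≤ d :=
        (Real.rpow_le_one_of_one_le_of_nonpos hM1 (by linarith)).trans hd1
      have hdc : (d : ℝ) ≤ (M : ℝ) ^ c :=
        hs.le.trans (Real.rpow_le_rpow_of_exponent_le hM1 (by linarith))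
      refine (htest M hM N hN d hd hck0 hdc).trans (le_trans ?_ (le_add_of_nonneg_left
        (by positivity)))
      rw [mul_assoc C]
      gcongr
      rw [add_mul, one_mul]
      have b1 : (M : ℝ) * ((M : ℝ) ^ (c - k) / d) ^ η ≤ Y := by
        rw [Real.div_rpow (by positivity) hd0.le, ← Real.rpow_mul hM0.le, div_eq_mul_inv,
          ← Real.rpow_neg hd0.le, ← mul_assoc]
        have e : (M : ℝ) * (M : ℝ) ^ ((c - k) * η) = (M : ℝ) ^ (1 - δ) := by
          have e' : 1 - δ = 1 + (c - k) * η := by rw [hδ, hη]; ring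
          rw [e', Real.rpow_add hM0, Real.rpow_one]
        rw [e, hY]
        gcongr ?_ * ?_
        exact Real.rpow_le_rpow_of_exponent_le hd1 (by linarith)
      have b2 : ((M : ℝ) ^ c / d) ^ (-β) ≤ (M : ℝ) ^ (-β) := by
        apply Real.rpow_le_rpow_of_nonpos hM0 _ (by linarith)
        rw [le_div_iff₀ hd0]
        calc (M : ℝ) * d ≤ (M : ℝ) ^ (1 : ℝ) * (M : ℝ) ^ (c - 1) := by
              rw [Real.rpow_one]; gcongr
          _ = _ := by rw [← Real.rpow_add hM0]; congr 1; ring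
      have b3 : (M : ℝ) ^ (1 + g / 2) * (M : ℝ) ^ (-β) ≤ 2 ^ (c * ε) * Y := by
        rw [← Real.rpow_add hM0]
        exact rpow_le_mul_rpow_of_modulus hε0.le hM1 hd0 hdM (by linarith)
      calc _ ≤ Y + (M : ℝ) ^ (1 + g / 2) * ((M : ℝ) ^ (-β) + (M : ℝ) ^ (-β)) := by gcongr
        _ = Y + 2 * ((M : ℝ) ^ (1 + g / 2) * (M : ℝ) ^ (-β)) := by ring
        _ ≤ Y + 2 * (2 ^ (c * ε) * Y) := by gcongr
        _ = _ := by ring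
  induction k, hk using Nat.le_induction with
  | base =>
    intro hck
    exact hdirect 2 le_rfl hck (by push_cast; norm_num; linarith)
  | succ k hk ih =>
    intro hck
    rcases lt_or_ge (((k + 1 : ℕ) : ℝ) - c) (2 - 2 / (2 : ℝ) ^ (k + 1)) with hgap | hgap
    · exact hdirect (k + 1) (by omega) hck hgap
    · have h4 := four_le_two_pow hk
      have h8 : 2 / (2 : ℝ) ^ (k + 1) = 1 / (2 : ℝ) ^ k := by rw [pow_succ]; field_simp
      have h9 : 1 / (2 : ℝ) ^ k ≤ 1 / 4 := one_div_le_one_div_of_le (by norm_num) h4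
      rw [h8] at hgap
      push_cast at hgap
      obtain ⟨ε, h1, h2, K, h3, h⟩ := ih (by linarith)
      refine ⟨ε, h1, h2, K, h3, fun M hM N hN d hd hdM => (h M hM N hN d hd hdM).trans ?_⟩
      gcongr K * (?_ * _)
      have hM1 : (1 : ℝ) ≤ M := by exact_mod_cast hM
      apply Real.rpow_le_rpow_of_exponent_le hM1
      have key : (((k + 1 : ℕ) : ℝ) - c) / ((2 : ℝ) ^ (k + 1) - 1) ≤
          ((k : ℝ) - c) / ((2 : ℝ) ^ k - 1) := by
        have h10 : (2 : ℝ) ≤ 2 ^ k := by linarith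
        rw [pow_succ, div_le_div_iff₀ (by linarith) (by linarith)]
        push_cast
        have h11 : (1 : ℝ) / 2 ^ k * 2 ^ k = 1 := by field_simp
        nlinarith
      linarith

/-- The distribution of `[m ^ c]` modulo `d` over an initial interval, for non-integral `c`. -/
theorem exists_abs_psCount_sub_le_of_not_nat {c : ℝ} (hc1 : 1 < c) (hc : ∀ n : ℕ, c ≠ n) {k : ℕ}
    (hk : 2 ≤ k) (hck : c < k) :
    ∃ ε : ℝ, 0 < ε ∧ c * ε ≤ 1 / 2 ∧ ∃ K : ℝ, 0 ≤ K ∧ ∀ d : ℕ, 2 ≤ d → ∀ X : ℕ,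
      |(psCount c d X : ℝ) - X / d| ≤
        K * ((X : ℝ) ^ (1 - (k - c) / ((2 : ℝ) ^ k - 1)) * (d : ℝ) ^ (-ε)) + 1 := by
  obtain ⟨ε, hε, hcε, K, hK, h⟩ := exists_abs_psBlockCount_sub_le_rpow hc1 hc hk hck
  refine ⟨ε, hε, hcε, 4 * K, by positivity, fun d hd X => ?_⟩
  have h4 := four_le_two_pow hk
  set δ := ((k : ℝ) - c) / ((2 : ℝ) ^ k - 1) with hδ
  have hδ3 : δ ≤ 1 / 3 := by
    refine le_trans ?_ (saving_le_third hk)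
    rw [hδ]
    gcongr
    linarith
  have hd0 : (0 : ℝ) < d := by exact_mod_cast (by omega : 0 < d)
  -- Split off the dyadic block `(X / 2, X]`; the errors of the blocks form a geometric series.
  induction X using Nat.strong_induction_on with
  | _ X ih =>
  rcases Nat.eq_zero_or_pos X with rfl | hX
  · simp only [psCount, Nat.cast_zero]
    simp
    positivity
  have hX1 : (1 : ℝ) ≤ X := by exact_mod_cast hX
  have hX0 : (0 : ℝ) < X := by linarith
  rcases lt_or_ge ((X : ℝ) ^ c) d with hlt | hge
  · have h1 := psCount_le_div hc1.le d X
    have h2 : (X : ℝ) ^ c / d < 1 := (div_lt_one hd0).2 hlt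
    have h3 : (X : ℝ) / d ≤ (X : ℝ) ^ c / d := by
      gcongr
      simpa using Real.rpow_le_rpow_of_exponent_le hX1 hc1.le
    have h5 : (0 : ℝ) ≤ psCount c d X := by positivity
    have h6 : (0 : ℝ) ≤ X / d := by positivity
    refine le_trans ?_ (le_add_of_nonneg_left (by positivity))
    rw [abs_le]; constructor <;> linarith
  · set Y := X / 2 with hYdef
    have hY := ih Y (by omega)
    have hB := h (Y + 1) (by omega) (X - Y) (by omega) d hd (hge.trans (by
      gcongr
      exact_mod_cast (by omega : X ≤ 2 * (Y + 1))))
    have hadd := psCount_add c d Y (X - Y)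
    rw [Nat.add_sub_cancel' (by omega : Y ≤ X)] at hadd
    have hcast : ((X - Y : ℕ) : ℝ) = X - Y := Nat.cast_sub (by omega)
    have e : (psCount c d X : ℝ) - X / d = ((psCount c d Y : ℝ) - Y / d) +
        ((psBlockCount c d (Y + 1) (X - Y) : ℝ) - ((X - Y : ℕ) : ℝ) / d) := by
      rw [hadd, hcast]; push_cast; ring
    rw [e]
    refine (abs_add_le _ _).trans ((add_le_add hY hB).trans ?_)
    have hY2 : (Y : ℝ) ^ (1 - δ) ≤ 3 / 4 * (X : ℝ) ^ (1 - δ) := by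
      have h1 : (Y : ℝ) ≤ 1 / 2 * X := by
        have : 2 * (Y : ℝ) ≤ X := by exact_mod_cast (by omega : 2 * Y ≤ X)
        linarith
      have h2 := Real.rpow_le_rpow (by positivity) h1 (by linarith : 0 ≤ 1 - δ)
      rw [Real.mul_rpow (by norm_num) hX0.le] at h2
      have h3 : (1 / 2 : ℝ) ^ (1 - δ) ≤ 3 / 4 := by
        have h5 := Real.rpow_le_rpow_of_exponent_ge (x := 1 / 2) (by norm_num) (by norm_num)
          (by linarith : (1 / 2 : ℝ) ≤ 1 - δ)
        rw [← Real.sqrt_eq_rpow] at h5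
        refine h5.trans ?_
        rw [Real.sqrt_le_left (by norm_num)]
        norm_num
      exact h2.trans (by gcongr)
    have hM2 : ((Y + 1 : ℕ) : ℝ) ^ (1 - δ) ≤ (X : ℝ) ^ (1 - δ) := by
      apply Real.rpow_le_rpow (by positivity) _ (by linarith)
      exact_mod_cast (by omega : Y + 1 ≤ X)
    calc _ ≤ 4 * K * ((3 / 4 * (X : ℝ) ^ (1 - δ)) * (d : ℝ) ^ (-ε)) + 1 +
          K * ((X : ℝ) ^ (1 - δ) * (d : ℝ) ^ (-ε)) := by gcongr
      _ = _ := by ring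

lemma one_le_rpow_mul_rpow_neg {c ε θ X d : ℝ} (hε : 0 ≤ ε) (hX : 1 ≤ X) (hd0 : 0 < d)
    (hd : d ≤ X ^ c) (h : c * ε ≤ θ) : 1 ≤ X ^ θ * d ^ (-ε) := by
  have h1 := Real.rpow_le_rpow_of_nonpos hd0 hd (by linarith : -ε ≤ 0)
  rw [← Real.rpow_mul (by linarith)] at h1
  calc 1 ≤ X ^ (θ + c * -ε) := Real.one_le_rpow hX (by linarith)
    _ = X ^ θ * X ^ (c * -ε) := Real.rpow_add (by linarith) _ _
    _ ≤ _ := by gcongr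

lemma psCount_natCast {n : ℕ} (hn : n ≠ 0) {d : ℕ} (hd : Squarefree d) (X : ℕ) :
    psCount n d X = X / d := by
  rw [← Nat.Ioc_filter_dvd_card_eq_div]
  unfold psCount
  congr 1
  ext m
  simp only [mem_filter, mem_Icc, mem_Ioc, psTerm, Real.rpow_natCast]
  rw [← Nat.cast_pow, Nat.floor_natCast, hd.dvd_pow_iff_dvd hn]
  rfl

/-- The distribution of `[m ^ c]` modulo a squarefree `d`, for every real `c ≥ 1`. For integral `c`
the condition `d ∣ m ^ c` is just `d ∣ m`. -/
theorem exists_abs_psCount_sub_le {c : ℝ} (hc1 : 1 ≤ c) {k : ℕ} (hk : 2 ≤ k) (hck : c < k) :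
    ∃ ε : ℝ, 0 < ε ∧ c * ε ≤ 1 / 2 ∧ ∃ K : ℝ, 0 ≤ K ∧ ∀ d : ℕ, Squarefree d → ∀ X : ℕ,
      1 ≤ X → (d : ℝ) ≤ (X : ℝ) ^ c → |(psCount c d X : ℝ) - X / d| ≤
        K * ((X : ℝ) ^ (1 - (k - c) / ((2 : ℝ) ^ k - 1)) * (d : ℝ) ^ (-ε)) := by
  have hδ3 : ((k : ℝ) - c) / ((2 : ℝ) ^ k - 1) ≤ 1 / 3 := by
    refine le_trans ?_ (saving_le_third hk)
    have h4 := four_le_two_pow hk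
    gcongr
    linarith
  by_cases hc : ∀ n : ℕ, c ≠ n
  · have hc1' : 1 < c := lt_of_le_of_ne hc1 (by simpa using (hc 1).symm)
    obtain ⟨ε, hε, hcε, K, hK, h⟩ := exists_abs_psCount_sub_le_of_not_nat hc1' hc hk hck
    refine ⟨ε, hε, hcε, K + 1, by positivity, fun d hd X hX hdX => ?_⟩
    have hX1 : (1 : ℝ) ≤ X := by exact_mod_cast hX
    have hd1 : 1 ≤ d := Nat.pos_of_ne_zero hd.ne_zero
    have hd0 : (0 : ℝ) < d := by exact_mod_cast hd1
    rcases hd1.eq_or_lt with rfl | hd2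
    · have : psCount c 1 X = X := by simp [psCount]
      rw [this]; simp; positivity
    · refine (h d hd2 X).trans ?_
      have := one_le_rpow_mul_rpow_neg hε.le hX1 hd0 hdX (hcε.trans (by linarith :
        (1 / 2 : ℝ) ≤ 1 - ((k : ℝ) - c) / ((2 : ℝ) ^ k - 1)))
      linarith
  · push Not at hc
    obtain ⟨n, rfl⟩ := hc
    have hn0 : (0 : ℝ) < n := by linarith
    refine ⟨1 / (2 * n), by positivity, by field_simp; norm_num, 1, zero_le_one,
      fun d hd X hX hdX => ?_⟩
    have hX1 : (1 : ℝ) ≤ X := by exact_mod_cast hX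
    have hd0 : (0 : ℝ) < d := by exact_mod_cast Nat.pos_of_ne_zero hd.ne_zero
    rw [psCount_natCast (by rintro rfl; simp at hn0) hd, one_mul]
    have := one_le_rpow_mul_rpow_neg (c := n) (ε := 1 / (2 * n)) (by positivity) hX1 hd0 hdX
      ((by field_simp; norm_num : (n : ℝ) * (1 / (2 * n)) ≤ 1 / 2).trans (by linarith :
        (1 / 2 : ℝ) ≤ 1 - ((k : ℝ) - n) / ((2 : ℝ) ^ k - 1)))
    refine le_trans ?_ this
    have h1 : ((X / d : ℕ) : ℝ) ≤ X / d := Nat.cast_div_le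
    have h2 : (X : ℝ) / d < ((X / d : ℕ) : ℝ) + 1 := by
      rw [div_lt_iff₀ hd0]
      exact_mod_cast Nat.lt_mul_of_div_lt (Nat.lt_succ_self _) (Nat.pos_of_ne_zero hd.ne_zero)
    rw [abs_le]; constructor <;> linarith

/-! ### Divisors and Möbius inversion -/

/-- The divisor bound `τ(n) ≪ n ^ ε`. -/
theorem exists_card_divisors_le {ε : ℝ} (hε : 0 < ε) :
    ∃ C : ℝ, 0 ≤ C ∧ ∀ n : ℕ, n ≠ 0 → (n.divisors.card : ℝ) ≤ C * (n : ℝ) ^ ε := by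
  -- A prime `p ≥ 2 ^ (1 / ε)` has `(p ^ ε) ^ a ≥ 2 ^ a ≥ a + 1`; the others each cost a factor `K`.
  set B := ⌈(2 : ℝ) ^ (1 / ε)⌉₊ with hB
  have hlog : 0 < Real.log 2 := Real.log_pos (by norm_num)
  set K : ℝ := 1 + 1 / (ε * Real.log 2) with hK
  have hK1 : 1 ≤ K := by have : 0 ≤ 1 / (ε * Real.log 2) := by positivity
                         linarith
  have hlocal : ∀ p a : ℕ, 2 ≤ p → ((a + 1 : ℕ) : ℝ) ≤
      (if p < B then K else 1) * ((p : ℝ) ^ a) ^ ε := by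
    intro p a hp
    have hp2 : (2 : ℝ) ≤ p := by exact_mod_cast hp
    split_ifs with h
    · have h1 : 1 + a * (ε * Real.log 2) ≤ ((p : ℝ) ^ a) ^ ε := by
        have h2 : ((2 : ℝ) ^ a) ^ ε ≤ ((p : ℝ) ^ a) ^ ε := by gcongr
        have h3 : ((2 : ℝ) ^ a) ^ ε = Real.exp (a * (ε * Real.log 2)) := by
          rw [← Real.rpow_natCast, ← Real.rpow_mul (by norm_num),
            Real.rpow_def_of_pos (by norm_num)]
          congr 1; ring
        have h4 := Real.add_one_le_exp (a * (ε * Real.log 2))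
        linarith
      refine le_trans ?_ (mul_le_mul_of_nonneg_left h1 (by linarith))
      have h5 : K * (1 + a * (ε * Real.log 2)) =
          1 + 1 / (ε * Real.log 2) + a * (ε * Real.log 2) + a := by
        rw [hK]; field_simp; ring
      rw [h5]; push_cast
      have : 0 ≤ 1 / (ε * Real.log 2) := by positivity
      have : 0 ≤ a * (ε * Real.log 2) := by positivity
      linarith
    · have h1 : (2 : ℝ) ^ (1 / ε) ≤ p := (Nat.le_ceil _).trans (by exact_mod_cast not_lt.1 h)
      have h2 : (2 : ℝ) ≤ (p : ℝ) ^ ε := by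
        have := Real.rpow_le_rpow (by positivity) h1 hε.le
        rwa [← Real.rpow_mul (by norm_num), one_div_mul_cancel hε.ne', Real.rpow_one] at this
      have h3 : ((p : ℝ) ^ a) ^ ε = ((p : ℝ) ^ ε) ^ a := by
        rw [← Real.rpow_natCast, ← Real.rpow_natCast, ← Real.rpow_mul (by linarith),
          ← Real.rpow_mul (by linarith), mul_comm]
      rw [one_mul, h3]
      calc ((a + 1 : ℕ) : ℝ) ≤ 2 ^ a := by exact_mod_cast Nat.lt_two_pow_self
        _ ≤ _ := by gcongr
  refine ⟨K ^ B, by positivity, fun n hn => ?_⟩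
  rw [Nat.card_divisors hn, Nat.cast_prod]
  calc _ ≤ ∏ p ∈ n.primeFactors, ((if p < B then K else 1) *
        ((p : ℝ) ^ n.factorization p) ^ ε) :=
        prod_le_prod (fun _ _ => by positivity) fun p hp =>
          hlocal p _ (Nat.prime_of_mem_primeFactors hp).two_le
    _ = (∏ p ∈ n.primeFactors, if p < B then K else 1) * (n : ℝ) ^ ε := by
        rw [prod_mul_distrib, Real.finsetProd_rpow _ _ (fun _ _ => by positivity)]
        congr 2
        conv_rhs => rw [← Nat.prod_factorization_pow_eq_self hn]
        rw [Finsupp.prod, Nat.support_factorization]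
        push_cast; rfl
    _ ≤ _ := by
        gcongr
        rw [prod_ite, prod_const_one, mul_one, prod_const]
        apply pow_le_pow_right₀ hK1
        calc _ ≤ (range B).card := card_le_card (fun p hp => by
              simp only [mem_filter, mem_range] at hp ⊢; exact hp.2)
          _ = B := card_range B

lemma sum_divisors_moebius (n : ℕ) :
    ∑ d ∈ n.divisors, ArithmeticFunction.moebius d = if n = 1 then 1 else 0 := by
  rw [← ArithmeticFunction.coe_mul_zeta_apply, ArithmeticFunction.moebius_mul_coe_zeta,
    ArithmeticFunction.one_apply]

/-- Möbius inversion for the number of coprime tuples. -/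
lemma coprimeCount_eq_sum_moebius {r : ℕ} {c : Fin r → ℝ} (hc : ∀ i, 1 ≤ c i) (i₀ : Fin r)
    (X : ℕ) : (coprimeCount c X : ℝ) =
      ∑ d ∈ Icc 1 (psTerm (c i₀) X), (ArithmeticFunction.moebius d : ℝ) *
        ∏ i, (psCount (c i) d X : ℝ) := by
  set T := Fintype.piFinset fun _ : Fin r => Icc 1 X with hT
  set g : (Fin r → ℕ) → ℕ := fun m => univ.gcd fun i => psTerm (c i) (m i) with hg
  set Z := psTerm (c i₀) X
  have h1 : (coprimeCount c X : ℝ) =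
      ∑ m ∈ T, ∑ d ∈ (Icc 1 Z).filter (fun d => d ∣ g m),
        (ArithmeticFunction.moebius d : ℝ) := by
    unfold coprimeCount
    rw [Nat.floor_natCast, card_filter]
    push_cast
    apply sum_congr rfl
    intro m hm
    have hmi : ∀ i, 1 ≤ m i ∧ m i ≤ X := by
      intro i; have := Fintype.mem_piFinset.1 hm i; simpa using this
    have hdvd : g m ∣ psTerm (c i₀) (m i₀) := gcd_dvd (mem_univ i₀)
    have hpos := psTerm_pos (hc i₀) (hmi i₀).1
    have hg0 : g m ≠ 0 := fun h => by rw [h, zero_dvd_iff] at hdvd; omega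
    have hgZ : g m ≤ Z := (Nat.le_of_dvd hpos hdvd).trans
      ((psTerm_strictMono (hc i₀)).monotone (hmi i₀).2)
    have : (Icc 1 Z).filter (fun d => d ∣ g m) = (g m).divisors := by
      ext d
      simp only [mem_filter, mem_Icc, Nat.mem_divisors]
      constructor
      · rintro ⟨_, h⟩; exact ⟨h, hg0⟩
      · rintro ⟨h, _⟩
        exact ⟨⟨Nat.pos_of_dvd_of_pos h (Nat.pos_of_ne_zero hg0),
          (Nat.le_of_dvd (Nat.pos_of_ne_zero hg0) h).trans hgZ⟩, h⟩
    rw [this]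
    have := sum_divisors_moebius (g m)
    have h2 : (∑ d ∈ (g m).divisors, (ArithmeticFunction.moebius d : ℝ)) =
        ((if g m = 1 then 1 else 0 : ℤ) : ℝ) := by rw [← this]; push_cast; rfl
    rw [h2]; push_cast; rfl
  rw [h1]
  simp only [sum_filter]
  rw [sum_comm]
  apply sum_congr rfl
  intro d _
  rw [← sum_filter, sum_const, nsmul_eq_mul, mul_comm]
  congr 1
  have : T.filter (fun m => d ∣ g m) =
      Fintype.piFinset fun i => (Icc 1 X).filter fun m => d ∣ psTerm (c i) m := by
    ext m
    simp only [hT, hg, mem_filter, Fintype.mem_piFinset, Finset.dvd_gcd_iff, mem_univ, true_imp_iff]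
    exact forall_and.symm
  rw [this, Fintype.card_piFinset]
  push_cast
  rfl

/-- On average over the moduli `d`, the values `[m ^ c]` have few divisors. -/
lemma sum_psCount_le {c : ℝ} (hc : 1 ≤ c) {ε : ℝ} (hε : 0 < ε) :
    ∃ C : ℝ, 0 ≤ C ∧ ∀ X Z : ℕ, 1 ≤ X →
      ∑ d ∈ Icc 1 Z, (psCount c d X : ℝ) ≤ C * (X : ℝ) ^ (1 + ε) := by
  have hc0 : 0 < c := by linarith
  obtain ⟨C, hC, h⟩ := exists_card_divisors_le (ε := ε / c) (by positivity)
  refine ⟨C, hC, fun X Z hX => ?_⟩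
  have hX0 : (0 : ℝ) < X := by exact_mod_cast hX
  have h1 : ∑ d ∈ Icc 1 Z, (psCount c d X : ℝ) =
      ∑ m ∈ Icc 1 X, (((Icc 1 Z).filter fun d => d ∣ psTerm c m).card : ℝ) := by
    unfold psCount
    simp only [card_filter]
    push_cast
    rw [sum_comm]
  rw [h1]
  calc _ ≤ ∑ m ∈ Icc 1 X, C * (X : ℝ) ^ ε := by
        refine sum_le_sum fun m hm => ?_
        rw [mem_Icc] at hm
        have hpos := psTerm_pos hc hm.1
        have h2 : (((Icc 1 Z).filter fun d => d ∣ psTerm c m).card : ℝ) ≤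
            (psTerm c m).divisors.card := by
          exact_mod_cast card_le_card fun d hd => by
            simp only [mem_filter, Nat.mem_divisors] at hd ⊢; exact ⟨hd.2, hpos.ne'⟩
        refine h2.trans ((h _ hpos.ne').trans ?_)
        gcongr
        have h3 : (psTerm c m : ℝ) ≤ (X : ℝ) ^ c :=
          (psTerm_le c m).trans (by gcongr; exact hm.2)
        have h4 := Real.rpow_le_rpow (by positivity) h3 (by positivity : 0 ≤ ε / c)
        rwa [← Real.rpow_mul hX0.le, mul_div_cancel₀ _ hc0.ne'] at h4
    _ = _ := by
        rw [sum_const, Nat.card_Icc, nsmul_eq_mul, Nat.add_sub_cancel, Real.rpow_add hX0,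
          Real.rpow_one]
        ring

/-- Truncating the series `∑ μ(d) / d ^ r = 1 / ζ(r)` at `D` costs at most `1 / D`. -/
lemma norm_one_div_riemannZeta_sub_le {r : ℕ} (hr : 2 ≤ r) {D : ℕ} (hD : 1 ≤ D) :
    ‖1 / riemannZeta r - ∑ d ∈ Icc 1 D, (ArithmeticFunction.moebius d : ℂ) / (d : ℂ) ^ r‖ ≤
      1 / D := by
  have hre : 1 < (r : ℂ).re := by rw [Complex.natCast_re]; exact_mod_cast hr
  set f : ℕ → ℂ := fun d => (ArithmeticFunction.moebius d : ℂ) / (d : ℂ) ^ r with hf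
  have hsum : HasSum f (1 / riemannZeta r) := by
    have h1 := (ArithmeticFunction.LSeriesSummable_moebius_iff.2 hre).LSeriesHasSum
    have h2 := ArithmeticFunction.LSeries_zeta_mul_Lseries_moebius hre
    rw [ArithmeticFunction.LSeries_zeta_eq_riemannZeta hre] at h2
    rw [one_div, ← eq_inv_of_mul_eq_one_right h2]
    unfold LSeriesHasSum at h1
    convert h1 using 1
    funext d
    rcases eq_or_ne d 0 with rfl | hd
    · simp [hf]
    · rw [LSeries.term_of_ne_zero hd, Complex.cpow_natCast]
  have ht := ((hsum.tendsto_sum_nat.comp (Filter.tendsto_add_atTop_nat 1)).sub_const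
    (∑ d ∈ Icc 1 D, f d)).norm
  refine le_of_tendsto ht (Filter.eventually_atTop.2 ⟨D, fun M hM => ?_⟩)
  have e : ∑ d ∈ range (M + 1), f d - ∑ d ∈ Icc 1 D, f d = ∑ d ∈ Ioc D M, f d := by
    have h0 : f 0 = 0 := by simp [hf]
    rw [sub_eq_iff_eq_add', range_eq_Ico, sum_eq_sum_Ico_succ_bot (by omega), h0, zero_add,
      ← sum_union]
    · congr 1; ext a; simp only [mem_Ico, mem_union, mem_Icc, mem_Ioc]; omega
    · rw [disjoint_left]; intro a; simp only [mem_Icc, mem_Ioc]; omega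
  simp only [Function.comp_apply]
  rw [e]
  refine (norm_sum_le _ _).trans ?_
  have h := sum_Ioc_rpow_le (a := 1) one_pos (H := D) hD M
  rw [div_one, Real.rpow_neg_one, ← one_div] at h
  refine le_trans (sum_le_sum fun d hd => ?_) h
  rw [mem_Ioc] at hd
  have hd1 : (1 : ℝ) ≤ d := by exact_mod_cast (by omega : 1 ≤ d)
  have hμ : ‖(ArithmeticFunction.moebius d : ℂ)‖ ≤ 1 := by
    rw [Complex.norm_intCast]
    exact_mod_cast ArithmeticFunction.abs_moebius_le_one (n := d)
  rw [hf]
  simp only [norm_div, norm_pow, Complex.norm_natCast]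
  rw [show (-1 - 1 : ℝ) = -((2 : ℕ) : ℝ) by norm_num, Real.rpow_neg (by linarith),
    Real.rpow_natCast, ← one_div]
  gcongr

/-- Comparing a product with a power, factor by factor. -/
lemma mul_abs_prod_sub_pow_le {ι : Type*} (s : Finset ι) (a : ι → ℝ) {b E u : ℝ} (hb : 0 ≤ b)
    (hbu : b ≤ u) (ha : ∀ i ∈ s, 0 ≤ a i ∧ a i ≤ u) (hE : ∀ i ∈ s, |a i - b| ≤ E) :
    u * |∏ i ∈ s, a i - b ^ s.card| ≤ s.card * E * u ^ s.card := by
  classical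
  have hu : 0 ≤ u := hb.trans hbu
  induction s using Finset.induction_on with
  | empty => simp
  | insert i s hi ih =>
    have ih' := ih (fun j hj => ha j (mem_insert_of_mem hj))
      (fun j hj => hE j (mem_insert_of_mem hj))
    rw [prod_insert hi, card_insert_of_notMem hi]
    have h0 := hE i (mem_insert_self i s)
    have hE0 : 0 ≤ E := (abs_nonneg _).trans h0
    have hP0 : 0 ≤ ∏ j ∈ s, a j := prod_nonneg fun j hj => (ha j (mem_insert_of_mem hj)).1
    have hP : ∏ j ∈ s, a j ≤ u ^ s.card :=
      (prod_le_prod (fun j hj => (ha j (mem_insert_of_mem hj)).1)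
        fun j hj => (ha j (mem_insert_of_mem hj)).2).trans (by rw [prod_const])
    have e : a i * ∏ j ∈ s, a j - b ^ (s.card + 1) =
        (a i - b) * ∏ j ∈ s, a j + b * (∏ j ∈ s, a j - b ^ s.card) := by ring
    rw [e]
    calc _ ≤ u * (|a i - b| * (∏ j ∈ s, a j) + b * |∏ j ∈ s, a j - b ^ s.card|) := by
          gcongr
          refine (abs_add_le _ _).trans (le_of_eq ?_)
          rw [abs_mul, abs_mul, abs_of_nonneg hP0, abs_of_nonneg hb]
      _ ≤ u * (E * u ^ s.card + u * |∏ j ∈ s, a j - b ^ s.card|) := by gcongr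
      _ ≤ u * (E * u ^ s.card + s.card * E * u ^ s.card) := by gcongr
      _ = _ := by push_cast; ring

/-! ### The asymptotic formula -/

/-- The asymptotic formula for an integral range `X`, from an equidistribution statement for each
of the sequences `[m ^ c i]` modulo squarefree `d`. -/
theorem exists_norm_coprimeCount_natCast_sub_le {r : ℕ} (hr : 2 ≤ r) {c : Fin r → ℝ}
    (hc : ∀ i, 1 ≤ c i) (i₀ : Fin r) (hi₀ : ∀ i, c i₀ ≤ c i) {δ ε K : ℝ} (hδ0 : 0 < δ)
    (hδ : δ ≤ 1 / 3) (hε0 : 0 < ε) (hε : ε ≤ 1 / 4) (hK : 0 ≤ K)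
    (hF : ∀ i, ∀ d : ℕ, Squarefree d → ∀ X : ℕ, 1 ≤ X → (d : ℝ) ≤ (X : ℝ) ^ c i →
      |(psCount (c i) d X : ℝ) - X / d| ≤ K * ((X : ℝ) ^ (1 - δ) * (d : ℝ) ^ (-ε))) :
    ∃ C : ℝ, 0 ≤ C ∧ ∀ X : ℕ, 1 ≤ X →
      ‖(coprimeCount c X : ℂ) - 1 / riemannZeta (r : ℂ) * (X : ℂ) ^ r‖ ≤
        C * (X : ℝ) ^ ((r : ℝ) - δ) := by
  -- The sum of the squared errors over `d ≤ X ^ ρ` is `X ^ (r - 2 * δ) * X ^ (ρ * (1 - 2 * ε))`, and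
  -- this choice of `ρ` makes it `X ^ (r - δ)`.
  set ρ := δ / (1 - 2 * ε) with hρ
  have hρ0 : 0 < ρ := div_pos hδ0 (by linarith)
  have hρε : ρ * (1 - 2 * ε) = δ := by rw [hρ, div_mul_cancel₀]; linarith
  have hρ1 : ρ ≤ 1 := by rw [hρ, div_le_one (by linarith)]; linarith
  obtain ⟨C₀, hC₀, hdiv⟩ := sum_psCount_le (hc i₀) (ε := ρ * ε) (by positivity)
  refine ⟨r * K * (1 + 1 / ε) + r * K ^ 2 * 2 + C₀ * (1 + K) + 2, by positivity, fun X hX => ?_⟩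
  obtain ⟨s, rfl⟩ : ∃ s, r = s + 2 := ⟨r - 2, by omega⟩
  have hX1 : (1 : ℝ) ≤ X := by exact_mod_cast hX
  have hX0 : (0 : ℝ) < X := by linarith
  set B := (X : ℝ) ^ (((s + 2 : ℕ) : ℝ) - δ) with hB
  have hXs : ∀ t : ℝ, (X : ℝ) ^ s * (X : ℝ) ^ t = (X : ℝ) ^ (s + t) := fun t => by
    rw [← Real.rpow_natCast, ← Real.rpow_add hX0]
  set Z := psTerm (c i₀) X with hZ
  -- Divisors up to `D = X ^ ρ` are treated with asymptotics, the larger ones with upper bounds.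
  set D := ⌊(X : ℝ) ^ ρ⌋₊ with hD
  have hXρ : 1 ≤ (X : ℝ) ^ ρ := Real.one_le_rpow hX1 hρ0.le
  have hD1 : 1 ≤ D := Nat.one_le_floor_iff _ |>.2 hXρ
  have hDle : (D : ℝ) ≤ (X : ℝ) ^ ρ := Nat.floor_le (by positivity)
  have hDlt : (X : ℝ) ^ ρ < D + 1 := Nat.lt_floor_add_one _
  have hDZ : D ≤ Z := by
    apply Nat.floor_le_floor
    exact Real.rpow_le_rpow_of_exponent_le hX1 (hρ1.trans (hc i₀))
  set E : ℕ → ℝ := fun d => K * ((X : ℝ) ^ (1 - δ) * (d : ℝ) ^ (-ε)) with hE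
  set P : ℕ → ℝ := fun d => ∏ i, (psCount (c i) d X : ℝ) with hP
  have hE0 : ∀ d, 0 ≤ E d := fun d => by positivity
  have herr : ∀ d, Squarefree d → d ≤ Z → ∀ i, |(psCount (c i) d X : ℝ) - X / d| ≤ E d := by
    intro d hd hdZ i
    apply hF i d hd X hX
    calc (d : ℝ) ≤ Z := by exact_mod_cast hdZ
      _ ≤ (X : ℝ) ^ c i₀ := psTerm_le _ _
      _ ≤ _ := Real.rpow_le_rpow_of_exponent_le hX1 (hi₀ i)
  -- All factors are at most `u d`; one of them is estimated by `X / d + E d`, the others by `X`.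
  set u : ℕ → ℝ := fun d => min (X / d + E d) X with hu
  have hupow : ∀ d, u d ^ (s + 1) ≤ (X / d + E d) * (X : ℝ) ^ s := by
    intro d
    have h0 : 0 ≤ u d := le_min (by have := hE0 d; positivity) hX0.le
    rw [pow_succ, mul_comm]
    gcongr
    · exact min_le_left _ _
    · exact min_le_right _ _
  have hfac : ∀ d, Squarefree d → d ≤ Z → ∀ i, 0 ≤ (psCount (c i) d X : ℝ) ∧
      (psCount (c i) d X : ℝ) ≤ u d := by
    intro d hd hdZ i
    refine ⟨by positivity, le_min ?_ (by exact_mod_cast psCount_le _ _ _)⟩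
    have := (abs_le.1 (herr d hd hdZ i)).2
    linarith
  have hsmall : ∀ d, 1 ≤ d → Squarefree d → d ≤ Z →
      |P d - (X / d : ℝ) ^ (s + 2)| ≤ (s + 2 : ℕ) * E d * ((X / d + E d) * (X : ℝ) ^ s) := by
    intro d hd1 hd hdZ
    have hd0 : (1 : ℝ) ≤ d := by exact_mod_cast hd1
    have hXd : 0 < (X : ℝ) / d := by positivity
    have hbu : (X : ℝ) / d ≤ u d := le_min (by linarith [hE0 d]) (div_le_self hX0.le hd0)
    have h := mul_abs_prod_sub_pow_le univ (fun i => (psCount (c i) d X : ℝ)) (b := X / d)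
      (E := E d) (u := u d) hXd.le hbu
      (fun i _ => hfac d hd hdZ i) (fun i _ => herr d hd hdZ i)
    rw [card_univ, Fintype.card_fin] at h
    have hu0 : 0 < u d := lt_of_lt_of_le hXd hbu
    have h' : u d * |P d - (X / d : ℝ) ^ (s + 2)| ≤ u d * ((s + 2 : ℕ) * E d * u d ^ (s + 1)) :=
      h.trans (le_of_eq (by rw [pow_succ _ (s + 1)]; ring))
    refine (le_of_mul_le_mul_left h' hu0).trans ?_
    have := hE0 d
    gcongr
    exact hupow d
  have hlarge : ∀ d, Squarefree d → d ≤ Z →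
      P d ≤ psCount (c i₀) d X * ((X / d + E d) * (X : ℝ) ^ s) := by
    intro d hd hdZ
    rw [hP]
    simp only
    rw [← mul_prod_erase univ _ (mem_univ i₀)]
    gcongr
    refine le_trans ?_ (hupow d)
    refine (prod_le_prod (fun i _ => (hfac d hd hdZ i).1) fun i _ => (hfac d hd hdZ i).2).trans
      (le_of_eq ?_)
    rw [prod_const, card_erase_of_mem (mem_univ i₀), card_univ, Fintype.card_fin]
    rfl
  have hμ1 : ∀ d, |(ArithmeticFunction.moebius d : ℝ)| ≤ 1 := fun d => by
    exact_mod_cast ArithmeticFunction.abs_moebius_le_one (n := d)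
  have hμ0 : ∀ d, ¬ Squarefree d → (ArithmeticFunction.moebius d : ℝ) = 0 := fun d hd => by
    rw [ArithmeticFunction.moebius_eq_zero_of_not_squarefree hd, Int.cast_zero]
  have hid := coprimeCount_eq_sum_moebius hc i₀ X
  have hsplit : Icc 1 Z = Icc 1 D ∪ Ioc D Z := by
    ext a; simp only [mem_union, mem_Icc, mem_Ioc]; omega
  have hdisj : Disjoint (Icc 1 D) (Ioc D Z) := by
    rw [disjoint_left]; intro a; simp only [mem_Icc, mem_Ioc]; omega
  rw [← hZ, hsplit, sum_union hdisj] at hid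
  have hpart1 : |∑ d ∈ Icc 1 D, (ArithmeticFunction.moebius d : ℝ) * P d -
      (X : ℝ) ^ (s + 2) * ∑ d ∈ Icc 1 D, (ArithmeticFunction.moebius d : ℝ) / (d : ℝ) ^ (s + 2)| ≤
      ((s + 2 : ℕ) * K * (1 + 1 / ε) + (s + 2 : ℕ) * K ^ 2 * 2) * B := by
    have e : ∑ d ∈ Icc 1 D, (ArithmeticFunction.moebius d : ℝ) * P d -
        (X : ℝ) ^ (s + 2) * ∑ d ∈ Icc 1 D, (ArithmeticFunction.moebius d : ℝ) / (d : ℝ) ^ (s + 2) =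
        ∑ d ∈ Icc 1 D, (ArithmeticFunction.moebius d : ℝ) * (P d - (X / d : ℝ) ^ (s + 2)) := by
      rw [mul_sum, ← sum_sub_distrib]
      apply sum_congr rfl; intro d _
      rw [div_pow]; ring
    rw [e]
    refine (abs_sum_le_sum_abs _ _).trans ?_
    have hterm : ∀ d ∈ Icc 1 D,
        |(ArithmeticFunction.moebius d : ℝ) * (P d - (X / d : ℝ) ^ (s + 2))| ≤
        (s + 2 : ℕ) * K * B * (d : ℝ) ^ (-1 - ε) +
          (s + 2 : ℕ) * K ^ 2 * (X : ℝ) ^ (s + (2 - 2 * δ)) * (d : ℝ) ^ ((1 - 2 * ε) - 1) := by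
      intro d hd
      rw [mem_Icc] at hd
      have hd0 : (0 : ℝ) < d := by exact_mod_cast hd.1
      rw [abs_mul]
      by_cases hsq : Squarefree d
      · calc _ ≤ 1 * ((s + 2 : ℕ) * E d * ((X / d + E d) * (X : ℝ) ^ s)) := by
              gcongr
              · exact hμ1 d
              · exact hsmall d hd.1 hsq (hd.2.trans hDZ)
          _ = (s + 2 : ℕ) * K * ((X : ℝ) ^ s * (X * (X : ℝ) ^ (1 - δ))) *
                ((d : ℝ) ^ (-ε) / d) + (s + 2 : ℕ) * K ^ 2 *
                ((X : ℝ) ^ s * ((X : ℝ) ^ (1 - δ) * (X : ℝ) ^ (1 - δ))) *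
                ((d : ℝ) ^ (-ε) * (d : ℝ) ^ (-ε)) := by rw [hE]; ring
          _ = _ := by
              have e1 : (X : ℝ) ^ s * (X * (X : ℝ) ^ (1 - δ)) = B := by
                rw [hB, mul_comm (X : ℝ), ← Real.rpow_add_one hX0.ne', hXs]
                congr 1; push_cast; ring
              rw [e1, ← Real.rpow_add hX0, hXs, ← Real.rpow_add hd0, ← Real.rpow_sub_one hd0.ne',
                show 1 - δ + (1 - δ) = 2 - 2 * δ by ring, show -1 - ε = -ε - 1 by ring,
                show 1 - 2 * ε - 1 = -ε + -ε by ring]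
      · rw [hμ0 d hsq, abs_zero, zero_mul]; positivity
    refine (sum_le_sum hterm).trans ?_
    rw [sum_add_distrib, ← mul_sum, ← mul_sum]
    have hs1 : ∑ d ∈ Icc 1 D, (d : ℝ) ^ (-1 - ε) ≤ 1 + 1 / ε := by
      have h := sum_Ioc_rpow_le hε0 one_pos D
      have e : Icc 1 D = insert 1 (Ioc 1 D) := by
        ext a; simp only [mem_insert, mem_Icc, mem_Ioc]; omega
      rw [e, sum_insert (by simp)]
      simpa using h
    have hs2 : ∑ d ∈ Icc 1 D, (d : ℝ) ^ ((1 - 2 * ε) - 1) ≤ 2 * (X : ℝ) ^ δ := by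
      have h := sum_rpow_sub_one_le (a := 1 - 2 * ε) (by linarith) (by linarith) D
      refine h.trans ?_
      have h2 := Real.rpow_le_rpow (by positivity) hDle (by linarith : 0 ≤ 1 - 2 * ε)
      rw [← Real.rpow_mul hX0.le, hρε] at h2
      rw [div_le_iff₀ (by linarith)]
      have : 0 ≤ (X : ℝ) ^ δ := by positivity
      nlinarith
    have e2 : (X : ℝ) ^ (s + (2 - 2 * δ)) * (X : ℝ) ^ δ = B := by
      rw [← Real.rpow_add hX0, hB]; congr 1; push_cast; ring
    calc _ ≤ (s + 2 : ℕ) * K * B * (1 + 1 / ε) +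
          (s + 2 : ℕ) * K ^ 2 * (X : ℝ) ^ (s + (2 - 2 * δ)) * (2 * (X : ℝ) ^ δ) := by gcongr
      _ = (s + 2 : ℕ) * K * B * (1 + 1 / ε) +
          (s + 2 : ℕ) * K ^ 2 * 2 * ((X : ℝ) ^ (s + (2 - 2 * δ)) * (X : ℝ) ^ δ) := by ring
      _ = _ := by rw [e2]; ring
  have hpart2 : |∑ d ∈ Ioc D Z, (ArithmeticFunction.moebius d : ℝ) * P d| ≤
      C₀ * (1 + K) * B := by
    refine (abs_sum_le_sum_abs _ _).trans ?_
    have hterm : ∀ d ∈ Ioc D Z, |(ArithmeticFunction.moebius d : ℝ) * P d| ≤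
        psCount (c i₀) d X * ((1 + K) * (X : ℝ) ^ (s + (1 - δ - ρ * ε))) := by
      intro d hd
      rw [mem_Ioc] at hd
      have hd0 : (0 : ℝ) < d := by exact_mod_cast (by omega : 0 < d)
      have hdX : (X : ℝ) ^ ρ ≤ d := by
        have : (D : ℝ) + 1 ≤ d := by exact_mod_cast hd.1
        linarith
      have hP0 : 0 ≤ P d := prod_nonneg fun i _ => by positivity
      rw [abs_mul, abs_of_nonneg hP0]
      by_cases hsq : Squarefree d
      · have h1 : (X : ℝ) / d ≤ (X : ℝ) ^ (1 - δ - ρ * ε) := by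
          rw [div_le_iff₀ hd0]
          calc (X : ℝ) = (X : ℝ) ^ (1 - ρ) * (X : ℝ) ^ ρ := by
                rw [← Real.rpow_add hX0]; simp
            _ ≤ (X : ℝ) ^ (1 - δ - ρ * ε) * d := by
                gcongr ?_ * ?_
                exact Real.rpow_le_rpow_of_exponent_le hX1 (by nlinarith)
        have h2 : E d ≤ K * (X : ℝ) ^ (1 - δ - ρ * ε) := by
          rw [hE]
          simp only
          gcongr
          have h3 := Real.rpow_le_rpow_of_nonpos (by positivity) hdX (by linarith : -ε ≤ 0)
          rw [← Real.rpow_mul hX0.le] at h3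
          calc _ ≤ (X : ℝ) ^ (1 - δ) * (X : ℝ) ^ (ρ * -ε) := by gcongr
            _ = _ := by rw [← Real.rpow_add hX0]; congr 1; ring
        calc _ ≤ 1 * (psCount (c i₀) d X * ((X / d + E d) * (X : ℝ) ^ s)) := by
              gcongr
              · exact hμ1 d
              · exact hlarge d hsq hd.2
          _ ≤ 1 * (psCount (c i₀) d X * (((X : ℝ) ^ (1 - δ - ρ * ε) +
                K * (X : ℝ) ^ (1 - δ - ρ * ε)) * (X : ℝ) ^ s)) := by gcongr
          _ = _ := by rw [← hXs]; ring
      · rw [hμ0 d hsq, abs_zero, zero_mul]; positivity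
    refine (sum_le_sum hterm).trans ?_
    rw [← sum_mul]
    have hsub : ∑ d ∈ Ioc D Z, (psCount (c i₀) d X : ℝ) ≤ C₀ * (X : ℝ) ^ (1 + ρ * ε) := by
      refine le_trans (sum_le_sum_of_subset_of_nonneg ?_ fun _ _ _ => by positivity)
        (hdiv X Z hX)
      rw [hsplit]; exact subset_union_right
    have e : (X : ℝ) ^ (1 + ρ * ε) * (X : ℝ) ^ (s + (1 - δ - ρ * ε)) = B := by
      rw [← Real.rpow_add hX0, hB]; congr 1; push_cast; ring
    calc _ ≤ C₀ * (X : ℝ) ^ (1 + ρ * ε) * ((1 + K) * (X : ℝ) ^ (s + (1 - δ - ρ * ε))) := by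
          gcongr
      _ = C₀ * (1 + K) * ((X : ℝ) ^ (1 + ρ * ε) * (X : ℝ) ^ (s + (1 - δ - ρ * ε))) := by ring
      _ = _ := by rw [e]
  have hpart3 : (X : ℝ) ^ (s + 2) * (1 / (D : ℝ)) ≤ 2 * B := by
    have h1 : 1 / (D : ℝ) ≤ 2 * (X : ℝ) ^ (-δ) := by
      have hD0 : (1 : ℝ) ≤ D := by exact_mod_cast hD1
      rw [Real.rpow_neg hX0.le, ← div_eq_mul_inv, div_le_div_iff₀ (by linarith) (by positivity)]
      have h2 : (X : ℝ) ^ δ ≤ (X : ℝ) ^ ρ := Real.rpow_le_rpow_of_exponent_le hX1 (by nlinarith)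
      linarith
    calc _ ≤ (X : ℝ) ^ (s + 2) * (2 * (X : ℝ) ^ (-δ)) := by gcongr
      _ = 2 * ((X : ℝ) ^ (s + 2) * (X : ℝ) ^ (-δ)) := by ring
      _ = _ := by
          rw [hB, ← Real.rpow_natCast, ← Real.rpow_add hX0, sub_eq_add_neg]
  have hζ := norm_one_div_riemannZeta_sub_le hr hD1
  set A := ∑ d ∈ Icc 1 D, (ArithmeticFunction.moebius d : ℝ) * P d
  set Q := ∑ d ∈ Ioc D Z, (ArithmeticFunction.moebius d : ℝ) * P d
  set m := ∑ d ∈ Icc 1 D, (ArithmeticFunction.moebius d : ℝ) / (d : ℝ) ^ (s + 2) with hm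
  have hmc : ∑ d ∈ Icc 1 D, (ArithmeticFunction.moebius d : ℂ) / (d : ℂ) ^ (s + 2) = (m : ℂ) := by
    rw [hm]; push_cast; rfl
  rw [hmc] at hζ
  have hfinal : (coprimeCount c X : ℂ) - 1 / riemannZeta ((s + 2 : ℕ) : ℂ) * (X : ℂ) ^ (s + 2) =
      ((A - (X : ℝ) ^ (s + 2) * m : ℝ) : ℂ) + (Q : ℂ) -
        (X : ℂ) ^ (s + 2) * (1 / riemannZeta ((s + 2 : ℕ) : ℂ) - m) := by
    have : (coprimeCount c X : ℂ) = ((A + Q : ℝ) : ℂ) := by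
      rw [← hid]; push_cast; rfl
    rw [this]; push_cast; ring
  rw [hfinal]
  refine (norm_sub_le _ _).trans ((add_le_add (norm_add_le _ _) le_rfl).trans ?_)
  rw [Complex.norm_real, Complex.norm_real, Real.norm_eq_abs, Real.norm_eq_abs, norm_mul, norm_pow,
    Complex.norm_natCast]
  have hζ' := (mul_le_mul_of_nonneg_left hζ (by positivity : 0 ≤ (X : ℝ) ^ (s + 2))).trans hpart3
  calc _ ≤ _ := add_le_add (add_le_add hpart1 hpart2) hζ'
    _ = _ := by ring

/-- Passing from integral to real ranges changes the main term by `O(x ^ (r - 1))` only. -/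
lemma exists_norm_coprimeCount_sub_le_of_nat {r : ℕ} (hr : 1 ≤ r) {c : Fin r → ℝ} {δ C : ℝ}
    (hδ : δ ≤ 1) (hC : 0 ≤ C) {ζ : ℂ}
    (h : ∀ X : ℕ, 1 ≤ X → ‖(coprimeCount c X : ℂ) - ζ * (X : ℂ) ^ r‖ ≤
        C * (X : ℝ) ^ ((r : ℝ) - δ)) :
    ∃ C' : ℝ, ∀ x : ℝ, 1 ≤ x → ‖(coprimeCount c x : ℂ) - ζ * (x : ℂ) ^ r‖ ≤
        C' * x ^ ((r : ℝ) - δ) := by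
  refine ⟨C + ‖ζ‖ * r, fun x hx => ?_⟩
  have hx0 : 0 < x := by linarith
  set X := ⌊x⌋₊ with hX
  have hX1 : 1 ≤ X := Nat.one_le_floor_iff _ |>.2 hx
  have hXx : (X : ℝ) ≤ x := Nat.floor_le hx0.le
  have hxX : x < X + 1 := Nat.lt_floor_add_one x
  have hcount : coprimeCount c x = coprimeCount c (X : ℝ) := by
    unfold coprimeCount; rw [Nat.floor_natCast]
  have hr1 : (1 : ℝ) ≤ r := by exact_mod_cast hr
  have hpow : x ^ r - (X : ℝ) ^ r ≤ r * x ^ ((r : ℝ) - δ) := by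
    have hb := one_add_mul_le_pow (a := (X : ℝ) / x - 1)
      (by have : 0 ≤ (X : ℝ) / x := by positivity
          linarith) r
    rw [add_sub_cancel, div_pow, le_div_iff₀ (by positivity)] at hb
    have h1 : x ^ r = x * x ^ (r - 1) := by
      rw [← pow_succ']; congr 1; omega
    have h2 : r * ((X : ℝ) / x - 1) * x ^ r = r * (X - x) * x ^ (r - 1) := by
      rw [h1]; field_simp
    have h3 : x ^ (r - 1) ≤ x ^ ((r : ℝ) - δ) := by
      rw [← Real.rpow_natCast, Nat.cast_sub hr]
      apply Real.rpow_le_rpow_of_exponent_le hx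
      push_cast; linarith
    have h4 : r * (x - X) * x ^ (r - 1) ≤ r * 1 * x ^ ((r : ℝ) - δ) := by
      gcongr
      linarith
    linarith
  have hpow0 : (X : ℝ) ^ r ≤ x ^ r := by gcongr
  have e : (coprimeCount c x : ℂ) - ζ * (x : ℂ) ^ r =
      ((coprimeCount c (X : ℝ) : ℂ) - ζ * (X : ℂ) ^ r) -
        ζ * ((x ^ r - (X : ℝ) ^ r : ℝ) : ℂ) := by
    rw [hcount]; push_cast; ring
  rw [e]
  refine (norm_sub_le _ _).trans ?_
  rw [norm_mul, Complex.norm_real, Real.norm_of_nonneg (by linarith), add_mul, mul_assoc]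
  gcongr
  refine (h X hX1).trans ?_
  gcongr
  linarith

theorem mainTheorem1 (r : ℕ) (hr : 2 ≤ r) (c : Fin r → ℝ)
    (hc1 : 1 ≤ c ⟨0, by omega⟩) (hmono : Monotone c) :
    (∀ k : ℕ, 2 ≤ k → c ⟨r - 1, by omega⟩ < (k : ℝ) →
      ∃ C : ℝ, ∀ x : ℝ, 1 ≤ x →
        ‖(coprimeCount c x : ℂ) - 1 / riemannZeta (r : ℂ) * (x : ℂ) ^ r‖ ≤
          C * x ^ ((r : ℝ) - ((k : ℝ) - c ⟨r - 1, by omega⟩) / ((2 : ℝ) ^ k - 1))) ∧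
    (∃ C : ℝ, ∀ x : ℝ, 1 ≤ x →
      ‖(coprimeCount c x : ℂ) - 1 / riemannZeta (r : ℂ) * (x : ℂ) ^ r‖ ≤
        C * x ^ ((r : ℝ) - (2 : ℝ) ^ (-(⌈c ⟨r - 1, by omega⟩⌉ + 1)))) := by
  have hmin : ∀ i, c ⟨0, by omega⟩ ≤ c i := fun i => hmono (Fin.mk_le_of_le_val (Nat.zero_le _))
  have hmax : ∀ i, c i ≤ c ⟨r - 1, by omega⟩ := fun i =>
    hmono (Fin.le_def.2 (by have := i.isLt; simp only; omega))
  have hc : ∀ i, 1 ≤ c i := fun i => hc1.trans (hmin i)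
  set cr := c ⟨r - 1, by omega⟩ with hcr
  have hcr1 : 1 ≤ cr := hc _
  have hfirst : ∀ k : ℕ, 2 ≤ k → cr < (k : ℝ) →
      ∃ C : ℝ, ∀ x : ℝ, 1 ≤ x →
        ‖(coprimeCount c x : ℂ) - 1 / riemannZeta (r : ℂ) * (x : ℂ) ^ r‖ ≤
          C * x ^ ((r : ℝ) - ((k : ℝ) - cr) / ((2 : ℝ) ^ k - 1)) := by
    intro k hk hck
    have h4 := four_le_two_pow hk
    set δ := ((k : ℝ) - cr) / ((2 : ℝ) ^ k - 1) with hδ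
    have hδ0 : 0 < δ := div_pos (by linarith) (by linarith)
    have hδ3 : δ ≤ 1 / 3 := by
      refine le_trans ?_ (saving_le_third hk)
      rw [hδ]
      gcongr
      linarith
    choose ε hε0 _ K hK hF using fun i =>
      exists_abs_psCount_sub_le (hc i) hk ((hmax i).trans_lt hck)
    have : Nonempty (Fin r) := ⟨⟨0, by omega⟩⟩
    set ε' := min (1 / 4) (univ.inf' univ_nonempty ε) with hε'
    have hε'0 : 0 < ε' := lt_min (by norm_num) ((lt_inf'_iff _).2 fun i _ => hε0 i)
    have hε'i : ∀ i, ε' ≤ ε i := fun i => (min_le_right _ _).trans (inf'_le _ (mem_univ i))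
    obtain ⟨C, hC, h⟩ := exists_norm_coprimeCount_natCast_sub_le hr hc ⟨0, by omega⟩ hmin hδ0 hδ3
      hε'0 (min_le_left _ _) (sum_nonneg fun i _ => hK i : 0 ≤ ∑ i, K i) (by
        intro i d hd X hX hdX
        refine (hF i d hd X hX hdX).trans ?_
        have hX1 : (1 : ℝ) ≤ X := by exact_mod_cast hX
        have hd1 : (1 : ℝ) ≤ d := by exact_mod_cast Nat.pos_of_ne_zero hd.ne_zero
        gcongr
        · exact sum_nonneg fun i _ => hK i
        · exact single_le_sum (fun i _ => hK i) (mem_univ i)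
        · exact div_le_div_of_nonneg_right (by linarith [hmax i]) (by linarith)
        · exact hε'i i)
    exact exists_norm_coprimeCount_sub_le_of_nat (by omega) (by linarith) hC h
  refine ⟨hfirst, ?_⟩
  set n := ⌈cr⌉.toNat with hn
  have hceil : (⌈cr⌉ : ℤ) = n := by
    rw [hn, Int.toNat_of_nonneg]; exact Int.ceil_nonneg (by linarith)
  have hcn : cr ≤ n := by
    have := Int.le_ceil cr
    rw [hceil] at this
    exact_mod_cast this
  have hn1 : 1 ≤ n := by
    have : (1 : ℝ) ≤ n := hcr1.trans hcn
    exact_mod_cast this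
  -- Order `⌈c_r⌉ + 1` gives a saving of at least `1 / (2 ^ (⌈c_r⌉ + 1) - 1)`.
  obtain ⟨C, hC⟩ := hfirst (n + 1) (by omega) (by push_cast; linarith)
  refine ⟨|C|, fun x hx => (hC x hx).trans ?_⟩
  have hx0 : 0 < x := by linarith
  refine (mul_le_mul_of_nonneg_right (le_abs_self C) (by positivity)).trans ?_
  gcongr
  have h4 := four_le_two_pow (by omega : 2 ≤ n + 1)
  rw [hceil, zpow_neg, show ((n : ℤ) + 1) = ((n + 1 : ℕ) : ℤ) by push_cast; rfl, zpow_natCast,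
    ← one_div]
  push_cast
  apply div_le_div₀ <;> linarith
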